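/- **Setting.** Let $s\ge 10$, $0<\theta<\frac13$, $2\theta<\delta_0<\frac23$ and $\sigma<s-\frac32$. Let $\mu_s$ be the law of the random Fourier series $$\sum_{k\in\mathbb Z^3}\frac{g_k}{\sqrt{1+|k|^{2s}}}\,e^{ik\cdot x}$$ on $\mathbb T^3=\mathbb R^3/(2\pi\mathbb Z)^3$, where the $g_k$ are independent standard complex Gaussian variables ($\mathbb E|g_k|^2=1$). Let $\chi\in C_c^\infty(\mathbb R^3;\mathbb R)$ be radial with $\chi=1$ on $[-\frac12,\frac12]^3$ and $\operatorname{supp}\chi\subset\{|x|<1\}$, and for an integer $N\ge1$ put $\chi_N(k)=\chi(k/N)$. Let $\eta\in C_c^\infty(\mathbb R;\mathbb R)$ with $\eta=1$ on $[-\frac12,\frac12]$ and $\operatorname{supp}\eta\subset(-1,1)$. For a function $v$ with Fourier coefficients $v_k$, let $w$ be the function with coefficients $w_k=\chi_N(k)v_k$. For $\vec k=(k_1,\dots,k_6)\in(\mathbb Z^3)^6$ put $$\psi_{2s}(\vec k)=\sum_{j=1}^6(-1)^{j-1}|k_j|^{2s},\qquad \Omega(\vec k)=\sum_{j=1}^6(-1)^{j-1}|k_j|^2,\qquad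 \lambda(\vec k)=\Big(\sum_{j=1}^6|k_j|^2\Big)^{1/2},$$ $$m(\vec k)=\Big(1-\eta\Big(\frac{\Omega(\vec k)}{\lambda(\vec k)^{\delta_0}}\Big)\Big)\frac{\psi_{2s}(\vec k)}{\Omega(\vec k)}\qquad(m(\vec k)=0\text{ if }\Omega(\vec k)=0).$$ The singular cross-generation pairing terms are the following sums over $\vec k\in(\mathbb Z^3)^6$ with $k_1-k_2+k_3-k_4+k_5-k_6=0$ and over $p$ (respectively $q$) in $(\mathbb Z^3)^5$; for given $N$ and $v$ only finitely many summands are nonzero: $$\mathcal S_{1,1}(w)=\sum_{\Lambda_{1,1}}\chi_N(k_1)^2|w_{k_2}|^2\,m(\vec k)\,w_{k_3}\overline w_{k_4}w_{k_5}\overline w_{k_6}\;\overline w_{p_2}w_{p_3}\overline w_{p_4}w_{p_5},$$ $$\mathcal S_{1,2}(w)=\sum_{\Lambda_{1,2}}\chi_N(k_1)^2|w_{k_3}|^2\,m(\vec k)\,\overline w_{k_2}\overline w_{k_4}w_{k_5}\overline w_{k_6}\;w_{p_1}w_{p_3}\overline w_{p_4}w_{p_5},$$ $$\mathcal S_{2,1}(w)=\sum_{\Lambda_{2,1}}\chi_N(k_2)^2|w_{k_1}|^2\,m(\vec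 k)\,w_{k_3}\overline w_{k_4}w_{k_5}\overline w_{k_6}\;\overline w_{q_3}w_{q_2}\overline w_{q_5}w_{q_4},$$ $$\mathcal S_{2,2}(w)=\sum_{\Lambda_{2,2}}\chi_N(k_2)^2|w_{k_4}|^2\,m(\vec k)\,w_{k_1}w_{k_3}w_{k_5}\overline w_{k_6}\;\overline w_{q_1}\overline w_{q_3}\overline w_{q_5}w_{q_4},$$ with the further constraints - $\Lambda_{1,1}$: $k_1=p_1-p_2+p_3-p_4+p_5$, $k_2=p_1$, and both $\sum_{i\in\{3,4,5,6\}}|k_i|$ and $\sum_{j\in\{2,3,4,5\}}|p_j|$ are at most $|k_1|^\theta+|k_2|^\theta$; - $\Lambda_{1,2}$: $k_1=p_1-p_2+p_3-p_4+p_5$, $k_3=p_2$, and both $\sum_{i\in\{2,4,5,6\}}|k_i|$ and $\sum_{j\in\{1,3,4,5\}}|p_j|$ are at most $|k_1|^\theta+|k_3|^\theta$; - $\Lambda_{2,1}$: $k_2=q_1-q_2+q_3-q_4+q_5$, $k_1=q_1$, and both $\sum_{i\in\{3,4,5,6\}}|k_i|$ and $\sum_{j\in\{2,3,4,5\}}|q_j|$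 are at most $|k_1|^\theta+|k_2|^\theta$; - $\Lambda_{2,2}$: $k_2=q_1-q_2+q_3-q_4+q_5$, $k_4=q_2$, and both $\sum_{i\in\{1,3,5,6\}}|k_i|$ and $\sum_{j\in\{1,3,4,5\}}|q_j|$ are at most $|k_2|^\theta+|k_4|^\theta$. Finally $B_R^{H^\sigma}=\{u:\|u\|_{H^\sigma}\le R\}$ with $\|u\|_{H^\sigma}^2=\sum_k(1+|k|^2)^\sigma|u_k|^2$. **Proposition.** Let $s\ge10$ and $0<\theta<\frac13$. There are $\beta=\beta(\theta,s)\in(0,1)$ and $\sigma_0<s-\frac32$ such that for all $\sigma\in(\sigma_0,s-\frac32)$, all $\delta_0\in(2\theta,\frac23)$ and all $\chi,\eta$ as above there is a constant $C>0$ such that for all $N\ge1$, $R\ge1$, $p\in[2,\infty)$ and $j\in\{1,2\}$, the function $v\mapsto\operatorname{Im}\big(\mathcal S_{1,j}(w)-\mathcal S_{2,j}(w)\big)\mathbf 1_{B_R^{H^\sigma}}(w)$ belongs to $L^p(d\mu_s(v))$ and $$\big\|\operatorname{Im}\big(\mathcal S_{1,j}(w)-\mathcal S_{2,j}(w)\big)\mathbf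 1_{B_R^{H^\sigma}}(w)\big\|_{L^p(d\mu_s)}\le C\,p^{\beta}R^{10}.$$ -/

import Mathlib

open MeasureTheory ProbabilityTheory
open scoped ContDiff NNReal ENNReal

noncomputable section

namespace NLSPairing

/-! ### Frequencies and Fourier coefficients

A function on the torus `ℝ³/(2πℤ)³` is represented by its family of Fourier coefficients
`u : Freq → ℂ`, that is, `u(x) = ∑ k, u k * exp (i k · x)`. -/

/-- Frequencies: the lattice `ℤ³`. -/
abbrev Freq : Type := Fin 3 → ℤ

/-- A frequency seen as a vector of the Euclidean space `ℝ³`. -/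
def freqVec (k : Freq) : EuclideanSpace ℝ (Fin 3) :=
  WithLp.toLp 2 (fun i => (k i : ℝ))

/-- The Euclidean length `|k|` of a frequency. -/
def freqNorm (k : Freq) : ℝ := ‖freqVec k‖

/-- The alternating sum `k₁ - k₂ + k₃ - ⋯` of a tuple of frequencies. Tuples are indexed from `0`
in the code, so that `k 0` is `k₁`, `k 1` is `k₂`, and so on. -/
def altSum {n : ℕ} (k : Fin n → Freq) : Freq := ∑ j : Fin n, (-1 : ℤ) ^ (j : ℕ) • k j

/-- The closed centred ball of radius `R` in `H^σ(𝕋³)`, with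
`‖u‖²_{H^σ} = ∑ k, (1 + |k|²)^σ |u k|²`. -/
def sobolevBall (σ R : ℝ) : Set (Freq → ℂ) :=
  {u | Summable (fun k : Freq => (1 + freqNorm k ^ 2) ^ σ * ‖u k‖ ^ 2) ∧
    Real.sqrt (∑' k : Freq, (1 + freqNorm k ^ 2) ^ σ * ‖u k‖ ^ 2) ≤ R}

/-! ### The Gaussian measure -/

/-- The standard complex Gaussian law `𝒩_ℂ(0, 1)`: independent real and imaginary parts, each
centred of variance `1/2`. -/
def stdComplexGaussian : Measure ℂ :=
  ((gaussianReal 0 (1 / 2 : ℝ≥0)).prod (gaussianReal 0 (1 / 2 : ℝ≥0))).map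
    Complex.measurableEquivRealProd.symm

instance : IsProbabilityMeasure stdComplexGaussian :=
  Measure.isProbabilityMeasure_map Complex.measurableEquivRealProd.symm.measurable.aemeasurable

/-- The law `μ_s` of the random Fourier series `∑ k, g_k / √(1 + |k|^{2s}) * exp (i k · x)`, with
`(g_k)` independent standard complex Gaussian variables. -/
def gaussianMeasure (s : ℝ) : Measure (Freq → ℂ) :=
  (Measure.infinitePi (fun _ : Freq => stdComplexGaussian)).map
    (fun g k => g k / ((Real.sqrt (1 + freqNorm k ^ (2 * s)) : ℝ) : ℂ))

instance (s : ℝ) : IsProbabilityMeasure (gaussianMeasure s) := by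
  have h : Measurable (fun (g : Freq → ℂ) (k : Freq) =>
      g k / ((Real.sqrt (1 + freqNorm k ^ (2 * s)) : ℝ) : ℂ)) :=
    measurable_pi_lambda _ fun k => (measurable_pi_apply k).div_const _
  exact Measure.isProbabilityMeasure_map h.aemeasurable

/-! ### Cutoffs -/

/-- Radial frequency cutoffs on `ℝ³`: smooth, equal to `1` on `[-1/2, 1/2]³`, with (closed) support
in the open unit ball. -/
structure IsRadialCutoff (χ : EuclideanSpace ℝ (Fin 3) → ℝ) : Prop where
  smooth : ContDiff ℝ ∞ χ
  radial : ∀ x y, ‖x‖ = ‖y‖ → χ x = χ y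
  eq_one : ∀ x, (∀ i, |x i| ≤ 1 / 2) → χ x = 1
  support_subset : tsupport χ ⊆ Metric.ball 0 1

/-- Bump functions on the line: smooth, equal to `1` on `[-1/2, 1/2]`, with (closed) support in
`(-1, 1)`. -/
structure IsBump (η : ℝ → ℝ) : Prop where
  smooth : ContDiff ℝ ∞ η
  eq_one : ∀ x, |x| ≤ 1 / 2 → η x = 1
  support_subset : tsupport η ⊆ Set.Ioo (-1) 1

/-- `χ_N(k) = χ(k / N)`. -/
def cutoffAt (χ : EuclideanSpace ℝ (Fin 3) → ℝ) (N : ℕ) (k : Freq) : ℝ :=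
  χ ((N : ℝ)⁻¹ • freqVec k)

/-- The smooth truncation `w = χ_N(√-Δ) v`, that is, `w_k = χ_N(k) v_k`. -/
def smoothTrunc (χ : EuclideanSpace ℝ (Fin 3) → ℝ) (N : ℕ) (v : Freq → ℂ) : Freq → ℂ :=
  fun k => (cutoffAt χ N k : ℂ) * v k

/-! ### Multipliers -/

/-- `ψ_{2s}(k) = |k₁|^{2s} - |k₂|^{2s} + ⋯ - |k₆|^{2s}`. -/
def psi (s : ℝ) (k : Fin 6 → Freq) : ℝ :=
  ∑ j : Fin 6, (-1 : ℝ) ^ (j : ℕ) * freqNorm (k j) ^ (2 * s)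

/-- The resonant function `Ω(k) = |k₁|² - |k₂|² + ⋯ - |k₆|²`. -/
def resonance (k : Fin 6 → Freq) : ℝ :=
  ∑ j : Fin 6, (-1 : ℝ) ^ (j : ℕ) * freqNorm (k j) ^ 2

/-- `λ(k) = (|k₁|² + ⋯ + |k₆|²)^{1/2}`. -/
def lam (k : Fin 6 → Freq) : ℝ := Real.sqrt (∑ j : Fin 6, freqNorm (k j) ^ 2)

/-- `(1 - η(Ω(k) / λ(k)^{δ₀})) ψ_{2s}(k) / Ω(k)`. The first factor vanishes where `Ω(k) = 0`. -/
def weight (η : ℝ → ℝ) (s δ₀ : ℝ) (k : Fin 6 → Freq) : ℝ :=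
  (1 - η (resonance k / lam k ^ δ₀)) * (psi s k / resonance k)

/-! ### The pairing sets

An element is a pair `(k, p)` of the six frequencies `k₁, …, k₆` of the first generation and of the
five children `p₁, …, p₅` of one of them (`k₁` for `Λ₁ⱼ`; for `Λ₂ⱼ` it is `k₂`, and the children
are called `q₁, …, q₅`). The parent is determined by its children, so listing it as well does not
change the sums. -/

/-- `Λ_{1,1}`: children of `k₁`, with `k₂ = p₁`. -/
def Lambda11 (θ : ℝ) : Set ((Fin 6 → Freq) × (Fin 5 → Freq)) :=
  {x | altSum x.1 = 0 ∧ x.1 0 = altSum x.2 ∧ x.1 1 = x.2 0 ∧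
    freqNorm (x.1 2) + freqNorm (x.1 3) + freqNorm (x.1 4) + freqNorm (x.1 5) ≤
      freqNorm (x.1 0) ^ θ + freqNorm (x.1 1) ^ θ ∧
    freqNorm (x.2 1) + freqNorm (x.2 2) + freqNorm (x.2 3) + freqNorm (x.2 4) ≤
      freqNorm (x.1 0) ^ θ + freqNorm (x.1 1) ^ θ}

/-- `Λ_{1,2}`: children of `k₁`, with `k₃ = p₂`. -/
def Lambda12 (θ : ℝ) : Set ((Fin 6 → Freq) × (Fin 5 → Freq)) :=
  {x | altSum x.1 = 0 ∧ x.1 0 = altSum x.2 ∧ x.1 2 = x.2 1 ∧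
    freqNorm (x.1 1) + freqNorm (x.1 3) + freqNorm (x.1 4) + freqNorm (x.1 5) ≤
      freqNorm (x.1 0) ^ θ + freqNorm (x.1 2) ^ θ ∧
    freqNorm (x.2 0) + freqNorm (x.2 2) + freqNorm (x.2 3) + freqNorm (x.2 4) ≤
      freqNorm (x.1 0) ^ θ + freqNorm (x.1 2) ^ θ}

/-- `Λ_{2,1}`: children of `k₂`, with `k₁ = q₁`. -/
def Lambda21 (θ : ℝ) : Set ((Fin 6 → Freq) × (Fin 5 → Freq)) :=
  {x | altSum x.1 = 0 ∧ x.1 1 = altSum x.2 ∧ x.1 0 = x.2 0 ∧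
    freqNorm (x.1 2) + freqNorm (x.1 3) + freqNorm (x.1 4) + freqNorm (x.1 5) ≤
      freqNorm (x.1 0) ^ θ + freqNorm (x.1 1) ^ θ ∧
    freqNorm (x.2 1) + freqNorm (x.2 2) + freqNorm (x.2 3) + freqNorm (x.2 4) ≤
      freqNorm (x.1 0) ^ θ + freqNorm (x.1 1) ^ θ}

/-- `Λ_{2,2}`: children of `k₂`, with `k₄ = q₂`. -/
def Lambda22 (θ : ℝ) : Set ((Fin 6 → Freq) × (Fin 5 → Freq)) :=
  {x | altSum x.1 = 0 ∧ x.1 1 = altSum x.2 ∧ x.1 3 = x.2 1 ∧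
    freqNorm (x.1 0) + freqNorm (x.1 2) + freqNorm (x.1 4) + freqNorm (x.1 5) ≤
      freqNorm (x.1 1) ^ θ + freqNorm (x.1 3) ^ θ ∧
    freqNorm (x.2 0) + freqNorm (x.2 2) + freqNorm (x.2 3) + freqNorm (x.2 4) ≤
      freqNorm (x.1 1) ^ θ + freqNorm (x.1 3) ^ θ}

/-! ### The singular pairing terms

They are only evaluated at truncated `w = smoothTrunc χ N v` with `1 ≤ N`. Such a `w` has finite
support, and every frequency of a pair `(k, p)` is determined by frequencies at which `w` is
evaluated, so only finitely many terms of each sum are nonzero. -/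

/-- `𝒮_{1,1}(w)`. -/
def S11 (χ : EuclideanSpace ℝ (Fin 3) → ℝ) (η : ℝ → ℝ) (s θ δ₀ : ℝ) (N : ℕ)
    (w : Freq → ℂ) : ℂ :=
  ∑' x : Lambda11 θ,
    let k := x.1.1
    let p := x.1.2
    ((cutoffAt χ N (k 0) ^ 2 * ‖w (k 1)‖ ^ 2 * weight η s δ₀ k : ℝ) : ℂ) *
      (w (k 2) * star (w (k 3)) * w (k 4) * star (w (k 5))) *
      (star (w (p 1)) * w (p 2) * star (w (p 3)) * w (p 4))

/-- `𝒮_{1,2}(w)`. -/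
def S12 (χ : EuclideanSpace ℝ (Fin 3) → ℝ) (η : ℝ → ℝ) (s θ δ₀ : ℝ) (N : ℕ)
    (w : Freq → ℂ) : ℂ :=
  ∑' x : Lambda12 θ,
    let k := x.1.1
    let p := x.1.2
    ((cutoffAt χ N (k 0) ^ 2 * ‖w (k 2)‖ ^ 2 * weight η s δ₀ k : ℝ) : ℂ) *
      (star (w (k 1)) * star (w (k 3)) * w (k 4) * star (w (k 5))) *
      (w (p 0) * w (p 2) * star (w (p 3)) * w (p 4))

/-- `𝒮_{2,1}(w)`. -/
def S21 (χ : EuclideanSpace ℝ (Fin 3) → ℝ) (η : ℝ → ℝ) (s θ δ₀ : ℝ) (N : ℕ)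
    (w : Freq → ℂ) : ℂ :=
  ∑' x : Lambda21 θ,
    let k := x.1.1
    let q := x.1.2
    ((cutoffAt χ N (k 1) ^ 2 * ‖w (k 0)‖ ^ 2 * weight η s δ₀ k : ℝ) : ℂ) *
      (w (k 2) * star (w (k 3)) * w (k 4) * star (w (k 5))) *
      (star (w (q 2)) * w (q 1) * star (w (q 4)) * w (q 3))

/-- `𝒮_{2,2}(w)`. -/
def S22 (χ : EuclideanSpace ℝ (Fin 3) → ℝ) (η : ℝ → ℝ) (s θ δ₀ : ℝ) (N : ℕ)
    (w : Freq → ℂ) : ℂ :=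
  ∑' x : Lambda22 θ,
    let k := x.1.1
    let q := x.1.2
    ((cutoffAt χ N (k 1) ^ 2 * ‖w (k 3)‖ ^ 2 * weight η s δ₀ k : ℝ) : ℂ) *
      (w (k 0) * w (k 2) * w (k 4) * star (w (k 5))) *
      (star (w (q 0)) * star (w (q 2)) * star (w (q 4)) * w (q 3))

/-- The function `v ↦ Im(𝒮_{1,1}(w) - 𝒮_{2,1}(w)) 1_{‖w‖_{H^σ} ≤ R}`, where `w = χ_N(√-Δ) v`. -/
def imDiff1 (χ : EuclideanSpace ℝ (Fin 3) → ℝ) (η : ℝ → ℝ) (s θ δ₀ σ R : ℝ) (N : ℕ)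
    (v : Freq → ℂ) : ℝ :=
  (sobolevBall σ R).indicator
    (fun w => (S11 χ η s θ δ₀ N w - S21 χ η s θ δ₀ N w).im) (smoothTrunc χ N v)

/-- The function `v ↦ Im(𝒮_{1,2}(w) - 𝒮_{2,2}(w)) 1_{‖w‖_{H^σ} ≤ R}`, where `w = χ_N(√-Δ) v`. -/
def imDiff2 (χ : EuclideanSpace ℝ (Fin 3) → ℝ) (η : ℝ → ℝ) (s θ δ₀ σ R : ℝ) (N : ℕ)
    (v : Freq → ℂ) : ℝ :=
  (sobolevBall σ R).indicator
    (fun w => (S12 χ η s θ δ₀ N w - S22 χ η s θ δ₀ N w).im) (smoothTrunc χ N v)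

end NLSPairing

end

open MeasureTheory ProbabilityTheory
open scoped ContDiff NNReal ENNReal

noncomputable section

namespace NLSPairing

/-! ### Frequencies -/

/-! Solving the momentum constraints turns each sum into a superposition, over pairs `(a, b)` of
low-frequency quadruples, of an eight-linear factor in `w` times a quadratic form `∑ D(n) |w_n|²` in
a single high frequency (`S11_eq_sum` and its three companions). On the Sobolev ball the
eight-linear factor is at most `R ^ 8` times a weight whose sum over `(a, b)` converges, even
against polynomial losses in the low frequencies (`sum_lowSize_le`). It remains to control the
quadratic form for fixed `(a, b)`.

The multiplier is comparable to its high-frequency quotient: the resonance function takes integer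
values, so `D(n)` is of order `⟨n⟩^(2s-2)` up to such losses (`weight_estimates`). The variance of
`w_n` being of order `⟨n⟩^(-2s)`, the products are of order `⟨n⟩^(-2)`, which in dimension three is
square summable but not summable. The fluctuations are therefore under control, while the means must
cancel.

Fluctuations. A quadratic form in Gaussians has moments growing like `p` in general. The exponent
one half comes from splitting at `⟨n⟩² = √p`. Below the threshold the Sobolev ball gives a
deterministic bound `√p R²`; above it the coefficients are at most `1/√p`, the Gaussian regime of
Bernstein's inequality (`eLpNorm_centredSum_le`, `eLpNorm_localizedForm_le`).

Means. Replacing the multiplier by its high-frequency quotient costs `⟨n⟩^(-10/3)`, which is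
summable. The leading parts vanish for two different reasons. For the first difference, a
translation produces a difference of variances, and the resulting sum is odd under the reflection
exchanging the two high frequencies (`tsum_diffSymbol_eq_zero`). For the second, the leading mean is
symmetric in `(a, b)` whereas the imaginary part of the low-frequency factor is antisymmetric
(`sum_lowAdd_mul_meanAdd`). -/

lemma freqNorm_nonneg (k : Freq) : 0 ≤ freqNorm k := norm_nonneg _

lemma freqVec_add (k l : Freq) : freqVec (k + l) = freqVec k + freqVec l := by
  ext i; simp [freqVec]

lemma freqVec_neg (k : Freq) : freqVec (-k) = -freqVec k := by
  ext i; simp [freqVec]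

lemma freqNorm_neg (k : Freq) : freqNorm (-k) = freqNorm k := by
  simp [freqNorm, freqVec_neg]

lemma freqNorm_add_le (k l : Freq) : freqNorm (k + l) ≤ freqNorm k + freqNorm l := by
  simpa [freqNorm, freqVec_add] using norm_add_le (freqVec k) (freqVec l)

lemma freqNorm_sub_le (k l : Freq) : freqNorm (k - l) ≤ freqNorm k + freqNorm l := by
  simpa [sub_eq_add_neg, freqNorm_neg] using freqNorm_add_le k (-l)

lemma freqNorm_sq (k : Freq) : freqNorm k ^ 2 = ((∑ i, k i ^ 2 : ℤ) : ℝ) := by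
  simp [freqNorm, freqVec, EuclideanSpace.norm_sq_eq]

lemma abs_coord_le_freqNorm (k : Freq) (i : Fin 3) : |(k i : ℝ)| ≤ freqNorm k := by
  simpa [freqNorm, freqVec] using PiLp.norm_apply_le (freqVec k) i

/-- The bracket `1 + |k|`. -/
def jb (k : Freq) : ℝ := 1 + freqNorm k

lemma one_le_jb (k : Freq) : 1 ≤ jb k := by
  have := freqNorm_nonneg k; unfold jb; linarith

lemma jb_pos (k : Freq) : 0 < jb k := by linarith [one_le_jb k]

lemma freqNorm_le_jb (k : Freq) : freqNorm k ≤ jb k := by unfold jb; linarith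

/-- Comparison with the sum of `‖z‖ ^ (-r)` over the lattice of integer points in Euclidean space.
-/
lemma summable_jb {r : ℝ} (hr : 3 < r) : Summable (fun k : Freq => jb k ^ (-r)) := by
  let b := (EuclideanSpace.basisFun (Fin 3) ℝ).toBasis
  let L := Submodule.span ℤ (Set.range b)
  have hfr : Module.finrank ℤ L = 3 := by
    have := ZLattice.rank ℝ L
    simpa using this
  have hmem : ∀ k : Freq, freqVec k ∈ L := by
    intro k
    rw [Module.Basis.mem_span_iff_repr_mem]
    intro i
    exact ⟨k i, by simp [b, freqVec]⟩
  have h1 : Summable (fun z : L => ‖z‖ ^ (-r)) :=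
    ZLattice.summable_norm_rpow (L := L) (-r) (by rw [hfr]; push_cast; linarith)
  have hinj : Function.Injective (fun k : Freq => (⟨freqVec k, hmem k⟩ : L)) := by
    intro k l h
    have h' : freqVec k = freqVec l := by simpa using h
    ext i
    have := congrArg (fun v : EuclideanSpace ℝ (Fin 3) => v i) h'
    simpa [freqVec] using this
  have h2 := h1.comp_injective hinj
  -- The real power `‖0‖ ^ (-r)` is zero by convention, so the term at the origin is added by hand.
  have h3 : Summable (fun k : Freq => if k = 0 then (1 : ℝ) else 0) :=
    (hasSum_ite_eq (0 : Freq) (1 : ℝ)).summable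
  refine Summable.of_nonneg_of_le (fun k => Real.rpow_nonneg (jb_pos k).le _) (fun k => ?_)
    (h2.add h3)
  by_cases hk : k = 0
  · subst hk
    have : 0 ≤ freqNorm (0 : Freq) ^ (-r) := Real.rpow_nonneg (freqNorm_nonneg _) _
    have h0 : freqNorm (0 : Freq) = 0 := by
      have : freqVec 0 = 0 := by ext i; simp [freqVec]
      rw [freqNorm, this, norm_zero]
    have h1 : jb (0 : Freq) ^ (-r) = 1 := by simp [jb, h0]
    rw [h1]
    simp only [Function.comp_def, if_true, le_add_iff_nonneg_left]
    positivity
  · have hpos : 0 < freqNorm k := by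
      rcases (freqNorm_nonneg k).lt_or_eq with h | h
      · exact h
      · exfalso
        apply hk
        ext i
        have := abs_coord_le_freqNorm k i
        rw [← h] at this
        simpa using abs_eq_zero.mp (le_antisymm this (abs_nonneg _))
    simp only [Function.comp_def, hk, if_false, add_zero]
    exact Real.rpow_le_rpow_of_nonpos hpos (freqNorm_le_jb k) (by linarith)

/-- The variance `1 / (1 + |k|^{2s})` of the coefficients under `gaussianMeasure s`. -/
def coeffVar (s : ℝ) (k : Freq) : ℝ := (1 + freqNorm k ^ (2 * s))⁻¹

lemma coeffVar_pos (s : ℝ) (k : Freq) : 0 < coeffVar s k := by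
  have := Real.rpow_nonneg (freqNorm_nonneg k) (2 * s)
  unfold coeffVar; positivity

lemma jb_rpow_le {s : ℝ} (hs : 0 ≤ s) (k : Freq) :
    jb k ^ (2 * s) ≤ 2 ^ (2 * s) * (1 + freqNorm k ^ (2 * s)) := by
  have h0 := freqNorm_nonneg k
  have hp := Real.rpow_nonneg h0 (2 * s)
  have h2 : jb k ≤ 2 * max 1 (freqNorm k) := by
    have := le_max_left 1 (freqNorm k); have := le_max_right 1 (freqNorm k)
    unfold jb; linarith
  calc jb k ^ (2 * s) ≤ (2 * max 1 (freqNorm k)) ^ (2 * s) :=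
        Real.rpow_le_rpow (jb_pos k).le h2 (by linarith)
    _ = 2 ^ (2 * s) * (max 1 (freqNorm k)) ^ (2 * s) := by
        rw [Real.mul_rpow (by norm_num) (by positivity)]
    _ ≤ _ := by
        gcongr
        rcases max_cases 1 (freqNorm k) with ⟨h, _⟩ | ⟨h, _⟩ <;> rw [h]
        · simpa using hp
        · linarith

lemma coeffVar_le {s : ℝ} (hs : 0 ≤ s) (k : Freq) :
    coeffVar s k ≤ 2 ^ (2 * s) * jb k ^ (-(2 * s)) := by
  have hp := Real.rpow_nonneg (freqNorm_nonneg k) (2 * s)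
  have hj := Real.rpow_pos_of_pos (jb_pos k) (2 * s)
  rw [Real.rpow_neg (jb_pos k).le, coeffVar, ← div_eq_mul_inv, inv_le_comm₀ (by positivity)
    (by positivity), inv_div, div_le_iff₀ (by positivity), mul_comm _ ((2 : ℝ) ^ _)]
  exact jb_rpow_le hs k

/-! ### The Sobolev ball -/

lemma sobolevBall_sum_le {σ R : ℝ} {u : Freq → ℂ} (hR : 0 ≤ R) (hu : u ∈ sobolevBall σ R)
    (S : Finset Freq) : ∑ k ∈ S, (1 + freqNorm k ^ 2) ^ σ * ‖u k‖ ^ 2 ≤ R ^ 2 := by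
  obtain ⟨h1, h2⟩ := hu
  have hn : ∀ k : Freq, 0 ≤ (1 + freqNorm k ^ 2) ^ σ * ‖u k‖ ^ 2 := fun k => by positivity
  calc _ ≤ ∑' k : Freq, (1 + freqNorm k ^ 2) ^ σ * ‖u k‖ ^ 2 := h1.sum_le_tsum S (fun k _ => hn k)
    _ ≤ R ^ 2 := (Real.sqrt_le_left hR).mp h2

lemma jb_sq_le (k : Freq) : jb k ^ 2 ≤ 2 * (1 + freqNorm k ^ 2) := by
  unfold jb; nlinarith [sq_nonneg (1 - freqNorm k)]

lemma jb_rpow_le_sobolev {σ : ℝ} (hσ : 0 ≤ σ) (k : Freq) :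
    jb k ^ (2 * σ) ≤ 2 ^ σ * (1 + freqNorm k ^ 2) ^ σ := by
  rw [← Real.mul_rpow (by norm_num) (by positivity), Real.rpow_mul (jb_pos k).le]
  have := jb_pos k
  exact Real.rpow_le_rpow (by positivity) (by simpa using jb_sq_le k) hσ

lemma norm_le_of_mem_sobolevBall {σ R : ℝ} {u : Freq → ℂ} (hσ : 0 ≤ σ) (hR : 0 ≤ R)
    (hu : u ∈ sobolevBall σ R) (k : Freq) : ‖u k‖ ≤ 2 ^ σ * R * jb k ^ (-σ) := by
  have h := sobolevBall_sum_le hR hu {k}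
  rw [Finset.sum_singleton] at h
  have hj := jb_rpow_le_sobolev hσ k
  have hjp := Real.rpow_pos_of_pos (jb_pos k) σ
  have h2 : (1 : ℝ) ≤ 2 ^ σ := Real.one_le_rpow (by norm_num) hσ
  have key : (jb k ^ σ * ‖u k‖) ^ 2 ≤ (2 ^ σ * R) ^ 2 := by
    calc (jb k ^ σ * ‖u k‖) ^ 2 = jb k ^ (2 * σ) * ‖u k‖ ^ 2 := by
          rw [mul_pow, mul_comm 2 σ, Real.rpow_mul (jb_pos k).le]; norm_cast
      _ ≤ 2 ^ σ * (1 + freqNorm k ^ 2) ^ σ * ‖u k‖ ^ 2 := by gcongr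
      _ ≤ 2 ^ σ * R ^ 2 := by rw [mul_assoc]; gcongr
      _ ≤ 2 ^ σ * (2 ^ σ * R ^ 2) := by
          have : 0 ≤ R ^ 2 := by positivity
          gcongr; nlinarith
      _ = _ := by ring
  have := abs_le_of_sq_le_sq' key (by positivity)
  rw [Real.rpow_neg (jb_pos k).le, ← div_eq_mul_inv, le_div_iff₀ hjp, mul_comm]
  exact this.2

/-! ### Exponential moments of the squares of Gaussian coefficients -/

/-- Variance `1/2` makes the density proportional to `exp (-x²)`, so the tilt only changes the rate
from `1` to `1 - t`. -/
lemma integral_exp_mul_sq_gaussian {t : ℝ} (ht : t < 1) :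
    Integrable (fun x : ℝ => Real.exp (t * x ^ 2)) (gaussianReal 0 (1 / 2 : ℝ≥0)) ∧
      ∫ x, Real.exp (t * x ^ 2) ∂(gaussianReal 0 (1 / 2 : ℝ≥0)) = (√(1 - t))⁻¹ := by
  have hv : (1 / 2 : ℝ≥0) ≠ 0 := by norm_num
  have hpdf : ∀ x : ℝ, gaussianPDFReal 0 (1 / 2 : ℝ≥0) x * Real.exp (t * x ^ 2) =
      (√Real.pi)⁻¹ * Real.exp (-(1 - t) * x ^ 2) := by
    intro x
    rw [gaussianPDFReal]
    push_cast
    rw [mul_assoc, ← Real.exp_add]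
    congr 2
    · congr 1; ring
    · ring
  constructor
  · rw [gaussianReal_of_var_ne_zero _ hv, integrable_withDensity_iff_integrable_smul'
      (measurable_gaussianPDF _ _) (ae_of_all _ fun x => ENNReal.ofReal_lt_top)]
    simp only [toReal_gaussianPDF, smul_eq_mul, hpdf]
    exact (integrable_exp_neg_mul_sq (by linarith)).const_mul _
  · rw [integral_gaussianReal_eq_integral_smul hv]
    simp only [smul_eq_mul, hpdf]
    rw [integral_const_mul, integral_gaussian, Real.sqrt_div Real.pi_pos.le, ← div_eq_inv_mul,
      div_div_cancel_left' (Real.sqrt_ne_zero'.mpr Real.pi_pos)]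

lemma norm_sq_equivRealProd_symm (z : ℝ × ℝ) :
    ‖Complex.measurableEquivRealProd.symm z‖ ^ 2 = z.1 ^ 2 + z.2 ^ 2 := by
  rw [← Complex.normSq_eq_norm_sq, Complex.normSq_apply]
  simp [Complex.measurableEquivRealProd, sq]

/-- Two independent real factors give exactly `exp (-t) / (1 - t)`. Bounding `exp (-t)` by `1 / (1 +
t)` leaves `1 / (1 - t²)`, which is at most `1 + 2 t²` in the given range. -/
lemma mgf_norm_sq_sub_one {t : ℝ} (ht : |t| ≤ 1 / 2) :
    Integrable (fun z : ℂ => Real.exp (t * (‖z‖ ^ 2 - 1))) stdComplexGaussian ∧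
      mgf (fun z : ℂ => ‖z‖ ^ 2 - 1) stdComplexGaussian t ≤ Real.exp (2 * t ^ 2) := by
  obtain ⟨ht1, ht2⟩ := abs_le.mp ht
  obtain ⟨hi, he⟩ := integral_exp_mul_sq_gaussian (t := t) (by linarith)
  have hfun : ∀ z : ℝ × ℝ,
      Real.exp (t * (‖Complex.measurableEquivRealProd.symm z‖ ^ 2 - 1)) =
        Real.exp (-t) * (Real.exp (t * z.1 ^ 2) * Real.exp (t * z.2 ^ 2)) := by
    intro z
    rw [norm_sq_equivRealProd_symm, ← Real.exp_add, ← Real.exp_add]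
    ring_nf
  constructor
  · rw [stdComplexGaussian, integrable_map_equiv]
    simp only [Function.comp_def, hfun]
    exact (hi.mul_prod hi).const_mul _
  · rw [mgf, stdComplexGaussian, MeasureTheory.integral_map_equiv]
    simp only [hfun]
    rw [integral_const_mul, integral_prod_mul (fun x => Real.exp (t * x ^ 2))
      (fun x => Real.exp (t * x ^ 2)), he, ← mul_inv, Real.mul_self_sqrt (by linarith)]
    have h1 : Real.exp (-t) ≤ (1 + t)⁻¹ := by
      rw [Real.exp_neg]
      exact inv_anti₀ (by linarith) (by linarith [Real.add_one_le_exp t])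
    have h3 : 0 < 1 - t ^ 2 := by nlinarith
    calc Real.exp (-t) * (1 - t)⁻¹ ≤ (1 + t)⁻¹ * (1 - t)⁻¹ := by
          have : 0 ≤ (1 - t)⁻¹ := inv_nonneg.mpr (by linarith)
          gcongr
      _ = (1 - t ^ 2)⁻¹ := by rw [← mul_inv]; congr 1; ring
      _ ≤ 1 + 2 * t ^ 2 := by
          rw [inv_le_iff_one_le_mul₀ h3]
          nlinarith [sq_nonneg t, mul_nonneg (sq_nonneg t) (by nlinarith : 0 ≤ 1 - 2 * t ^ 2)]
      _ ≤ _ := by linarith [Real.add_one_le_exp (2 * t ^ 2)]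

/-- The law of a family of independent standard complex Gaussian variables. -/
abbrev gaussianFamily : Measure (Freq → ℂ) :=
  Measure.infinitePi (fun _ : Freq => stdComplexGaussian)

/-- A centred quadratic form `∑ α_n (|g_n|² - 1)`. -/
def centredSum (S : Finset Freq) (α : Freq → ℝ) (g : Freq → ℂ) : ℝ :=
  ∑ n ∈ S, α n * (‖g n‖ ^ 2 - 1)

lemma measurable_centredSum (S : Finset Freq) (α : Freq → ℝ) :
    Measurable (centredSum S α) := by
  unfold centredSum
  fun_prop

lemma exp_centredSum (S : Finset Freq) (α : Freq → ℝ) (t : ℝ)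
    (h : ∀ n ∈ S, |t * α n| ≤ 1 / 2) :
    Integrable (fun g => Real.exp (t * centredSum S α g)) gaussianFamily ∧
      ∫ g, Real.exp (t * centredSum S α g) ∂gaussianFamily ≤
        Real.exp (2 * t ^ 2 * ∑ n ∈ S, α n ^ 2) := by
  let X : Freq → (Freq → ℂ) → ℝ := fun n g => α n * (‖g n‖ ^ 2 - 1)
  have hind : iIndepFun X gaussianFamily :=
    iIndepFun_infinitePi (X := fun n (z : ℂ) => α n * (‖z‖ ^ 2 - 1)) (fun n => by fun_prop)
  have hmeas : ∀ n, Measurable (X n) := fun n => by fun_prop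
  have hmp := fun n => measurePreserving_eval_infinitePi (fun _ : Freq => stdComplexGaussian) n
  have hfun : ∀ n g, Real.exp (t * X n g) =
      (fun z : ℂ => Real.exp ((t * α n) * (‖z‖ ^ 2 - 1))) (Function.eval n g) := by
    intro n g; simp only [X, Function.eval]; ring_nf
  have hint : ∀ n ∈ S, Integrable (fun g => Real.exp (t * X n g)) gaussianFamily := by
    intro n hn
    simp only [hfun]
    exact (hmp n).integrable_comp_of_integrable (mgf_norm_sq_sub_one (h n hn)).1
  have hmgf : ∀ n ∈ S, mgf (X n) gaussianFamily t ≤ Real.exp (2 * (t * α n) ^ 2) := by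
    intro n hn
    have : mgf (X n) gaussianFamily t =
        mgf (fun z : ℂ => ‖z‖ ^ 2 - 1) stdComplexGaussian (t * α n) := by
      rw [mgf, mgf]
      simp only [hfun]
      rw [← (hmp n).map_eq, integral_map (hmp n).measurable.aemeasurable]
      exact Measurable.aestronglyMeasurable (by fun_prop)
    rw [this]
    exact (mgf_norm_sq_sub_one (h n hn)).2
  have hsum : ∀ g, (∑ n ∈ S, X n) g = centredSum S α g := fun g => by
    simp [X, centredSum]
  have h1 := hind.integrable_exp_mul_sum hmeas hint
  have h2 := hind.mgf_sum (t := t) hmeas S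
  rw [mgf] at h2
  simp only [hsum] at h1 h2
  refine ⟨h1, h2.le.trans ?_⟩
  calc ∏ n ∈ S, mgf (X n) gaussianFamily t ≤ ∏ n ∈ S, Real.exp (2 * (t * α n) ^ 2) :=
        Finset.prod_le_prod (fun _ _ => mgf_nonneg) hmgf
    _ = _ := by
        rw [← Real.exp_sum, Finset.mul_sum]
        congr 1
        exact Finset.sum_congr rfl fun n _ => by ring

/-- The Gaussian regime of Bernstein's inequality. The sup bound on the coefficients lets the
exponential moment be taken at a parameter of size `√p / A`, and the `ℓ²` bound makes it at most
`exp (p / 2)` there; this gives growth `√p` instead of the `p` of a general second-order chaos. -/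
lemma eLpNorm_centredSum_le (S : Finset Freq) (α : Freq → ℝ) {A p : ℝ} (hA : 0 < A)
    (hp : 1 ≤ p) (h1 : ∀ n ∈ S, |α n| ≤ A / √p) (h2 : ∑ n ∈ S, α n ^ 2 ≤ A ^ 2) :
    eLpNorm (centredSum S α) (ENNReal.ofReal p) gaussianFamily ≤
      ENNReal.ofReal (8 * A * √p) := by
  have hp0 : 0 < p := by linarith
  have hsp : 0 < √p := Real.sqrt_pos.mpr hp0
  -- The largest parameter for which `|t α_n| ≤ 1/2` follows from the sup bound; it also turns `2 t²
  -- A²` into `p / 2`.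
  set t : ℝ := √p / (2 * A) with ht
  have ht0 : 0 < t := by positivity
  have hpt : p / t = 2 * A * √p := by
    rw [ht]; field_simp; rw [Real.sq_sqrt hp0.le]
  have hbd : ∀ τ : ℝ, |τ| = t → ∀ n ∈ S, |τ * α n| ≤ 1 / 2 := by
    intro τ hτ n hn
    rw [abs_mul, hτ]
    calc t * |α n| ≤ t * (A / √p) := by gcongr; exact h1 n hn
      _ = 1 / 2 := by rw [ht]; field_simp
  have hexp : ∀ τ : ℝ, |τ| = t →
      Integrable (fun g => Real.exp (τ * centredSum S α g)) gaussianFamily ∧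
      ∫ g, Real.exp (τ * centredSum S α g) ∂gaussianFamily ≤ Real.exp (p / 2) := by
    intro τ hτ
    obtain ⟨ha, hb⟩ := exp_centredSum S α τ (hbd τ hτ)
    refine ⟨ha, hb.trans (Real.exp_le_exp.mpr ?_)⟩
    have : τ ^ 2 = t ^ 2 := by rw [← hτ, sq_abs]
    rw [this]
    calc 2 * t ^ 2 * ∑ n ∈ S, α n ^ 2 ≤ 2 * t ^ 2 * A ^ 2 := by gcongr
      _ = p / 2 := by rw [ht]; field_simp; rw [Real.sq_sqrt hp0.le]
  obtain ⟨hi1, hb1⟩ := hexp t (abs_of_pos ht0)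
  obtain ⟨hi2, hb2⟩ := hexp (-t) (by rw [abs_neg, abs_of_pos ht0])
  have hpt' : ∀ y : ℝ, |y| ^ p ≤ (p / t) ^ p * (Real.exp (t * y) + Real.exp (-t * y)) := by
    intro y
    have e1 : t * |y| / p ≤ Real.exp (t * |y| / p) := by
      linarith [Real.add_one_le_exp (t * |y| / p)]
    have e2 : (t * |y| / p) ^ p ≤ Real.exp (t * |y|) := by
      calc _ ≤ (Real.exp (t * |y| / p)) ^ p := Real.rpow_le_rpow (by positivity) e1 hp0.le
        _ = _ := by rw [← Real.exp_mul]; congr 1; field_simp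
    have e3 : Real.exp (t * |y|) ≤ Real.exp (t * y) + Real.exp (-t * y) := by
      rcases abs_cases y with ⟨h, _⟩ | ⟨h, _⟩ <;> rw [h]
      · linarith [Real.exp_pos (-t * y)]
      · have := Real.exp_pos (t * y)
        rw [show t * -y = -t * y by ring]; linarith
    calc |y| ^ p = (p / t) ^ p * (t * |y| / p) ^ p := by
          rw [← Real.mul_rpow (by positivity) (by positivity)]
          congr 1; field_simp
      _ ≤ _ := by gcongr; exact e2.trans e3
  have hp' : (ENNReal.ofReal p).toReal = p := ENNReal.toReal_ofReal hp0.le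
  rw [eLpNorm_eq_lintegral_rpow_enorm_toReal (by simpa using hp0) ENNReal.ofReal_ne_top, hp']
  have hint : Integrable (fun g => (p / t) ^ p * (Real.exp (t * centredSum S α g) +
      Real.exp (-t * centredSum S α g))) gaussianFamily := (hi1.add hi2).const_mul _
  have hle : ∫⁻ g, ‖centredSum S α g‖ₑ ^ p ∂gaussianFamily ≤
      ENNReal.ofReal ((p / t) ^ p * (2 * Real.exp (p / 2))) := by
    calc ∫⁻ g, ‖centredSum S α g‖ₑ ^ p ∂gaussianFamily
        ≤ ∫⁻ g, ENNReal.ofReal ((p / t) ^ p * (Real.exp (t * centredSum S α g) +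
          Real.exp (-t * centredSum S α g))) ∂gaussianFamily := by
          refine lintegral_mono fun g => ?_
          rw [← ofReal_norm, ENNReal.ofReal_rpow_of_nonneg (norm_nonneg _) hp0.le,
            Real.norm_eq_abs]
          exact ENNReal.ofReal_le_ofReal (hpt' _)
      _ = ENNReal.ofReal (∫ g, (p / t) ^ p * (Real.exp (t * centredSum S α g) +
          Real.exp (-t * centredSum S α g)) ∂gaussianFamily) :=
          (ofReal_integral_eq_lintegral_ofReal hint (ae_of_all _ fun g => by positivity)).symm
      _ ≤ _ := by
          refine ENNReal.ofReal_le_ofReal ?_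
          rw [integral_const_mul, integral_add hi1 hi2]
          gcongr
          linarith
  calc (∫⁻ g, ‖centredSum S α g‖ₑ ^ p ∂gaussianFamily) ^ (1 / p)
      ≤ (ENNReal.ofReal ((p / t) ^ p * (2 * Real.exp (p / 2)))) ^ (1 / p) := by gcongr
    _ = ENNReal.ofReal (((p / t) ^ p * (2 * Real.exp (p / 2))) ^ (1 / p)) :=
        ENNReal.ofReal_rpow_of_nonneg (by positivity) (by positivity)
    _ ≤ ENNReal.ofReal (((p / t) ^ p * (4 : ℝ) ^ p) ^ (1 / p)) := by
        -- After the `p`-th root this contributes a factor `4`, which with `p / t = 2 A √p` gives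
        -- the constant `8`.
        have e4 : 2 * Real.exp (p / 2) ≤ (4 : ℝ) ^ p := by
          have a1 : (2 : ℝ) ≤ 2 ^ p := by simpa using
            Real.rpow_le_rpow_of_exponent_le (by norm_num : (1 : ℝ) ≤ 2) hp
          have a2 : Real.exp (p / 2) ≤ 2 ^ p := by
            rw [show p / 2 = (1 / 2) * p by ring, Real.exp_mul]
            refine Real.rpow_le_rpow (by positivity) ?_ hp0.le
            have b1 : Real.exp (1 / 2) ^ 2 = Real.exp 1 := by
              rw [← Real.exp_nat_mul]; norm_num
            nlinarith [Real.exp_one_lt_d9, Real.exp_pos (1 / 2)]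
          calc _ ≤ (2 : ℝ) ^ p * 2 ^ p := by gcongr
            _ = 4 ^ p := by rw [← Real.mul_rpow (by norm_num) (by norm_num)]; norm_num
        gcongr
    _ = ENNReal.ofReal (8 * A * √p) := by
        rw [← Real.mul_rpow (by positivity) (by positivity), ← Real.rpow_mul (by positivity),
          mul_one_div_cancel hp0.ne', Real.rpow_one, hpt]
        congr 1; ring

/-! ### Quadratic forms in the coefficients weighted by functions bounded on Sobolev balls -/

/-- Minkowski's inequality on a probability space. The random weights have already been replaced by
their deterministic bounds `c`, so only the norms of the `Y j` enter. -/
lemma eLpNorm_le_of_abs_le_add_sum {Ω ι : Type*} [MeasurableSpace Ω] {μ : Measure Ω}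
    [IsProbabilityMeasure μ] {q : ℝ≥0∞} (hq : 1 ≤ q) (J : Finset ι) {f : Ω → ℝ} {Y : ι → Ω → ℝ}
    {a : ℝ} {c B : ι → ℝ} (ha : 0 ≤ a) (hc : ∀ j ∈ J, 0 ≤ c j) (hB0 : ∀ j ∈ J, 0 ≤ B j)
    (hY : ∀ j ∈ J, Measurable (Y j)) (hB : ∀ j ∈ J, eLpNorm (Y j) q μ ≤ ENNReal.ofReal (B j))
    (hf : ∀ x, |f x| ≤ a + ∑ j ∈ J, c j * |Y j x|) :
    eLpNorm f q μ ≤ ENNReal.ofReal (a + ∑ j ∈ J, c j * B j) := by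
  have hq0 : q ≠ 0 := (zero_lt_one.trans_le hq).ne'
  have hterm : ∀ j ∈ J, AEStronglyMeasurable (fun x => c j * |Y j x|) μ := fun j hj => by
    have := hY j hj
    exact (by fun_prop : Measurable (fun x => c j * |Y j x|)).aestronglyMeasurable
  have hs : AEStronglyMeasurable (∑ j ∈ J, fun x => c j * |Y j x|) μ :=
    Finset.aestronglyMeasurable_sum J hterm
  calc eLpNorm f q μ ≤ eLpNorm ((fun _ => a) + ∑ j ∈ J, fun x => c j * |Y j x|) q μ :=
        eLpNorm_mono_real fun x => by simpa [Finset.sum_apply] using hf x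
    _ ≤ eLpNorm (fun _ => a) q μ + eLpNorm (∑ j ∈ J, fun x => c j * |Y j x|) q μ :=
        eLpNorm_add_le aestronglyMeasurable_const hs hq
    _ ≤ ENNReal.ofReal a + ∑ j ∈ J, ENNReal.ofReal (c j * B j) := by
        gcongr
        · rw [eLpNorm_const _ hq0 (NeZero.ne μ)]
          simp [Real.enorm_eq_ofReal ha]
        · refine (eLpNorm_sum_le hterm hq).trans (Finset.sum_le_sum fun j hj => ?_)
          have h1 : eLpNorm (fun x => c j * |Y j x|) q μ = ENNReal.ofReal (c j) *
              eLpNorm (Y j) q μ := by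
            have := eLpNorm_const_smul (p := q) (μ := μ) (c j) (fun x => |Y j x|)
            rw [Real.enorm_eq_ofReal (hc j hj)] at this
            rw [← eLpNorm_norm (Y j)]
            exact this
          rw [h1, ENNReal.ofReal_mul (hc j hj)]
          gcongr
          exact hB j hj
    _ = _ := by
        have h0 : ∀ j ∈ J, 0 ≤ c j * B j := fun j hj => mul_nonneg (hc j hj) (hB0 j hj)
        rw [ENNReal.ofReal_add ha (Finset.sum_nonneg h0), ENNReal.ofReal_sum_of_nonneg h0]

/-- Multiplication of the Fourier coefficients by a real symbol. -/
def symbolMul (χ : Freq → ℝ) (v : Freq → ℂ) : Freq → ℂ := fun k => (χ k : ℂ) * v k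

lemma measurable_symbolMul (χ : Freq → ℝ) : Measurable (symbolMul χ) :=
  measurable_pi_lambda _ fun k => (measurable_pi_apply k).const_mul _

/-- A symbol supported in a finite box reduces the Sobolev norm to a finite sum and makes
summability automatic. -/
lemma measurableSet_symbolMul_mem_sobolevBall {χ : Freq → ℝ} {box : Finset Freq}
    (hχ : ∀ k ∉ box, χ k = 0) (σ R : ℝ) :
    MeasurableSet {v | symbolMul χ v ∈ sobolevBall σ R} := by
  have h : ∀ v : Freq → ℂ, ∀ k ∉ box, (1 + freqNorm k ^ 2) ^ σ * ‖symbolMul χ v k‖ ^ 2 = 0 := by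
    intro v k hk
    simp [symbolMul, hχ k hk]
  have : {v | symbolMul χ v ∈ sobolevBall σ R} =
      {v | √(∑ k ∈ box, (1 + freqNorm k ^ 2) ^ σ * ‖symbolMul χ v k‖ ^ 2) ≤ R} := by
    ext v
    simp only [sobolevBall, Set.mem_ofPred_eq, tsum_eq_sum (h v), and_iff_right_iff_imp]
    exact fun _ => summable_of_ne_finset_zero (h v)
  rw [this]
  refine measurableSet_le ?_ measurable_const
  have := measurable_symbolMul χ
  have h2 : ∀ k, Measurable fun v => symbolMul χ v k := fun k =>
    (measurable_pi_apply k).comp this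
  exact Measurable.sqrt (Finset.measurable_sum _ fun k _ => ((h2 k).norm.pow_const 2).const_mul _)

/-- The random coefficients with law `gaussianMeasure s`. -/
def gaussianCoeff (s : ℝ) (g : Freq → ℂ) : Freq → ℂ :=
  fun k => g k / ((Real.sqrt (1 + freqNorm k ^ (2 * s)) : ℝ) : ℂ)

lemma measurable_gaussianCoeff (s : ℝ) : Measurable (gaussianCoeff s) :=
  measurable_pi_lambda _ fun k => (measurable_pi_apply k).div_const _

lemma norm_sq_symbolMul_gaussianCoeff (s : ℝ) (χ : Freq → ℝ) (g : Freq → ℂ) (k : Freq) :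
    ‖symbolMul χ (gaussianCoeff s g) k‖ ^ 2 = χ k ^ 2 * coeffVar s k * ‖g k‖ ^ 2 := by
  have hp := Real.rpow_nonneg (freqNorm_nonneg k) (2 * s)
  rw [symbolMul, gaussianCoeff, norm_mul, norm_div, mul_pow, div_pow, Complex.norm_real,
    Complex.norm_real, Real.norm_eq_abs, Real.norm_eq_abs, sq_abs, sq_abs,
    Real.sq_sqrt (by positivity), coeffVar]
  ring

/-- The quadratic form `∑_j L_j(w) ∑_n D_j(n) |w_n|²` restricted to a Sobolev ball. -/
def localizedForm {ι : Type} (σ R : ℝ) (J : Finset ι) (box : Finset Freq)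
    (L : ι → (Freq → ℂ) → ℝ) (D : ι → Freq → ℝ) : (Freq → ℂ) → ℝ :=
  (sobolevBall σ R).indicator (fun w => ∑ j ∈ J, L j w * ∑ n ∈ box, D j n * ‖w n‖ ^ 2)

lemma measurable_localizedForm {ι : Type} (σ R : ℝ) (J : Finset ι) {box : Finset Freq}
    {L : ι → (Freq → ℂ) → ℝ} (D : ι → Freq → ℝ) {χ : Freq → ℝ} (hχ : ∀ k ∉ box, χ k = 0)
    (hL : ∀ j ∈ J, Measurable (L j)) :
    Measurable (fun v => localizedForm σ R J box L D (symbolMul χ v)) := by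
  have hm : Measurable (fun w : Freq → ℂ => ∑ j ∈ J, L j w * ∑ n ∈ box, D j n * ‖w n‖ ^ 2) :=
    Finset.measurable_sum _ fun j hj => (hL j hj).mul (by fun_prop)
  exact (hm.comp (measurable_symbolMul χ)).indicator
    (measurableSet_symbolMul_mem_sobolevBall hχ σ R)

/-- The weight `2s - 2` exceeds that of `H^(s-2)` by two powers of the bracket, which are paid for
by `B`. In the application `B = √p`. -/
lemma low_sum_le {s σ R B : ℝ} (hs : 2 ≤ s) (hσ : s - 2 ≤ σ) (hR : 0 ≤ R)
    {u : Freq → ℂ} (hu : u ∈ sobolevBall σ R) (S : Finset Freq)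
    (hB : 0 ≤ B) (hS : ∀ n ∈ S, jb n ^ 2 ≤ B) :
    ∑ n ∈ S, jb n ^ (2 * s - 2) * ‖u n‖ ^ 2 ≤ B * 2 ^ s * R ^ 2 := by
  calc ∑ n ∈ S, jb n ^ (2 * s - 2) * ‖u n‖ ^ 2
      ≤ ∑ n ∈ S, B * 2 ^ s * ((1 + freqNorm n ^ 2) ^ σ * ‖u n‖ ^ 2) := by
        refine Finset.sum_le_sum fun n hn => ?_
        rw [← mul_assoc]
        gcongr
        calc jb n ^ (2 * s - 2) = jb n ^ 2 * jb n ^ (2 * (s - 2)) := by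
              rw [← Real.rpow_natCast, ← Real.rpow_add (jb_pos n)]; congr 1; push_cast; ring
          _ ≤ B * (2 ^ (s - 2) * (1 + freqNorm n ^ 2) ^ (s - 2)) := by
              have := jb_pos n
              gcongr
              · exact hS n hn
              · exact jb_rpow_le_sobolev (by linarith) n
          _ ≤ B * (2 ^ s * (1 + freqNorm n ^ 2) ^ σ) := by
              have h1 : 1 ≤ 1 + freqNorm n ^ 2 := by nlinarith [sq_nonneg (freqNorm n)]
              gcongr
              · norm_num
              · linarith
          _ = _ := by ring
    _ ≤ _ := by
        rw [← Finset.mul_sum]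
        gcongr
        exact sobolevBall_sum_le hR hu S

lemma jb_mul_coeffVar_le {s : ℝ} (hs : 0 ≤ s) (n : Freq) :
    jb n ^ (2 * s - 2) * coeffVar s n ≤ 2 ^ (2 * s) * jb n ^ (-2 : ℝ) := by
  have h := Real.rpow_nonneg (jb_pos n).le (2 * s - 2)
  calc _ ≤ jb n ^ (2 * s - 2) * (2 ^ (2 * s) * jb n ^ (-(2 * s))) := by
        gcongr; exact coeffVar_le hs n
    _ = 2 ^ (2 * s) * (jb n ^ (2 * s - 2) * jb n ^ (-(2 * s))) := by ring
    _ = _ := by rw [← Real.rpow_add (jb_pos n)]; congr 2; ring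

/-- The probabilistic core. The numbers `E j` are leading parts of the means: they need not be small
individually, but their total contribution against the weights `L j w` vanishes for every `w`. They
can thus be subtracted before absolute values are taken. The eight low factors give `R ^ 8`, and the
quadratic form gives the remaining `R ^ 2`. -/
theorem eLpNorm_localizedForm_le (s Cχ : ℝ) (hs : 2 ≤ s) :
    ∃ C : ℝ, 0 < C ∧ ∀ (ι : Type) (J : Finset ι) (box : Finset Freq) (χ : Freq → ℝ)
      (L : ι → (Freq → ℂ) → ℝ) (D : ι → Freq → ℝ) (κ K E : ι → ℝ) (σ R p Q : ℝ),
      s - 2 ≤ σ → 1 ≤ R → 1 ≤ p → (∀ k ∉ box, χ k = 0) → (∀ k, |χ k| ≤ Cχ) →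
      (∀ j ∈ J, Measurable (L j)) → (∀ j ∈ J, 0 ≤ κ j) → (∀ j ∈ J, 0 < K j) →
      (∀ j ∈ J, ∀ w ∈ sobolevBall σ R, |L j w| ≤ R ^ 8 * κ j) →
      (∀ j ∈ J, ∀ n ∈ box, |D j n| ≤ K j * jb n ^ (2 * s - 2)) →
      (∀ j ∈ J, |∑ n ∈ box, D j n * (χ n ^ 2 * coeffVar s n) - E j| ≤ K j) →
      (∀ w, ∑ j ∈ J, L j w * E j = 0) → (∑ j ∈ J, κ j * K j ≤ Q) →
      eLpNorm (fun v => localizedForm σ R J box L D (symbolMul χ v)) (ENNReal.ofReal p)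
        (gaussianMeasure s) ≤ ENNReal.ofReal (C * Q * √p * R ^ 10) := by
  set S4 : ℝ := ∑' n : Freq, (jb n ^ (-2 : ℝ)) ^ 2 with hS4
  have hsum4 : Summable fun n : Freq => (jb n ^ (-2 : ℝ)) ^ 2 := by
    refine (summable_jb (r := 4) (by norm_num)).congr fun n => ?_
    rw [← Real.rpow_natCast, ← Real.rpow_mul (jb_pos n).le]; norm_num
  have hS4n : 0 ≤ S4 := tsum_nonneg fun n => sq_nonneg _
  have hS4le : ∀ S : Finset Freq, ∑ n ∈ S, (jb n ^ (-2 : ℝ)) ^ 2 ≤ S4 := fun S =>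
    hsum4.sum_le_tsum S fun n _ => sq_nonneg _
  set c : ℝ := Cχ ^ 2 * 2 ^ (2 * s) + 1 with hc
  have hc0 : 0 < c := by positivity
  set c1 : ℝ := 2 ^ s + c * S4 + 1 with hc1
  have hc10 : 0 < c1 := by positivity
  refine ⟨c1 + 8 * (c * (1 + S4)), by positivity, ?_⟩
  intro ι J box χ L D κ K E σ R p Q hσ hR hp hχ hχb hLm hκ hK hL hD hE h0 hQ
  have hp0 : 0 < p := by linarith
  have hsp : 0 < √p := Real.sqrt_pos.mpr hp0
  have hsp1 : 1 ≤ √p := Real.one_le_sqrt.mpr hp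
  have hmeas := measurable_localizedForm σ R J D hχ hLm
  have hgm : gaussianMeasure s = gaussianFamily.map (gaussianCoeff s) := rfl
  rw [hgm, eLpNorm_map_measure hmeas.aestronglyMeasurable
    (measurable_gaussianCoeff s).aemeasurable]
  classical
  -- This threshold balances both sides: the Sobolev bound on `lo` loses `⟨n⟩² ≤ √p`, and on `hi`
  -- the normalized coefficients are `O(⟨n⟩^(-2))`, hence `O(1/√p)` as `eLpNorm_centredSum_le`
  -- requires.
  let lo := box.filter fun n => jb n ^ 2 ≤ √p
  let hi := box.filter fun n => ¬ jb n ^ 2 ≤ √p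
  let α : ι → Freq → ℝ := fun j n => D j n * (χ n ^ 2 * coeffVar s n)
  have hα : ∀ j ∈ J, ∀ n ∈ box, |α j n| ≤ K j * c * jb n ^ (-2 : ℝ) := by
    intro j hj n hn
    have h1 := hD j hj n hn
    have h2 : χ n ^ 2 ≤ Cχ ^ 2 := by
      rw [← sq_abs]; exact pow_le_pow_left₀ (abs_nonneg _) (hχb n) 2
    have h3 := coeffVar_pos s n
    have h4 := Real.rpow_pos_of_pos (jb_pos n) (2 * s - 2)
    have h5 := Real.rpow_pos_of_pos (jb_pos n) (-2)
    have hKj := hK j hj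
    calc |α j n| = |D j n| * (χ n ^ 2 * coeffVar s n) := by
          simp only [α]; rw [abs_mul, abs_of_nonneg (a := χ n ^ 2 * coeffVar s n) (by positivity)]
      _ ≤ (K j * jb n ^ (2 * s - 2)) * (Cχ ^ 2 * coeffVar s n) := by gcongr
      _ = K j * Cχ ^ 2 * (jb n ^ (2 * s - 2) * coeffVar s n) := by ring
      _ ≤ K j * Cχ ^ 2 * (2 ^ (2 * s) * jb n ^ (-2 : ℝ)) := by
          exact mul_le_mul_of_nonneg_left (jb_mul_coeffVar_le (by linarith) n) (by positivity)
      _ = K j * (Cχ ^ 2 * 2 ^ (2 * s)) * jb n ^ (-2 : ℝ) := by ring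
      _ ≤ _ := by gcongr; rw [hc]; linarith
  have hm2 : ∀ n : Freq, jb n ^ (-2 : ℝ) = (jb n ^ 2)⁻¹ := fun n => by
    rw [Real.rpow_neg (jb_pos n).le]; norm_cast
  have hY : ∀ j ∈ J, eLpNorm (centredSum hi (α j)) (ENNReal.ofReal p) gaussianFamily ≤
      ENNReal.ofReal (8 * (K j * c * (1 + S4)) * √p) := by
    intro j hj
    have hKj := hK j hj
    refine eLpNorm_centredSum_le hi (α j) (by positivity) hp (fun n hn => ?_) ?_
    · obtain ⟨hn1, hn2⟩ := Finset.mem_filter.mp hn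
      refine (hα j hj n hn1).trans ?_
      rw [hm2, div_eq_mul_inv]
      have : (jb n ^ 2)⁻¹ ≤ (√p)⁻¹ := inv_anti₀ hsp (not_le.mp hn2).le
      refine mul_le_mul ?_ this (by positivity) (by positivity)
      exact le_mul_of_one_le_right (by positivity) (by linarith)
    · calc ∑ n ∈ hi, α j n ^ 2 ≤ ∑ n ∈ hi, (K j * c) ^ 2 * (jb n ^ (-2 : ℝ)) ^ 2 := by
            refine Finset.sum_le_sum fun n hn => ?_
            rw [← mul_pow, ← sq_abs]
            exact pow_le_pow_left₀ (abs_nonneg _) (hα j hj n (Finset.mem_filter.mp hn).1) 2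
        _ ≤ (K j * c) ^ 2 * S4 := by
            rw [← Finset.mul_sum]; gcongr; exact hS4le hi
        _ ≤ (K j * c) ^ 2 * (1 + S4) ^ 2 := by gcongr; nlinarith
        _ = _ := by ring
  have hpt : ∀ g, |((fun v => localizedForm σ R J box L D (symbolMul χ v)) ∘ gaussianCoeff s) g| ≤
      (∑ j ∈ J, κ j * K j) * (c1 * √p * R ^ 10) +
        ∑ j ∈ J, (R ^ 8 * κ j) * |centredSum hi (α j) g| := by
    intro g
    have hrn : 0 ≤ (∑ j ∈ J, κ j * K j) * (c1 * √p * R ^ 10) +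
        ∑ j ∈ J, (R ^ 8 * κ j) * |centredSum hi (α j) g| := by
      refine add_nonneg (mul_nonneg (Finset.sum_nonneg fun j hj =>
        mul_nonneg (hκ j hj) (hK j hj).le) (by positivity)) (Finset.sum_nonneg fun j hj => ?_)
      have := hκ j hj
      positivity
    set w := symbolMul χ (gaussianCoeff s g) with hw
    simp only [Function.comp_apply, localizedForm, ← hw]
    by_cases hball : w ∈ sobolevBall σ R
    swap
    · rw [Set.indicator_of_notMem hball, abs_zero]; exact hrn
    rw [Set.indicator_of_mem hball]
    have hX : ∀ j ∈ J, |∑ n ∈ box, D j n * ‖w n‖ ^ 2 - E j| ≤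
        K j * (c1 * √p * R ^ 2) + |centredSum hi (α j) g| := by
      intro j hj
      have hKj := hK j hj
      -- Only the high part is centred. The low part stays uncentred, and its mean is subtracted at
      -- the end because the bound on the mean concerns the whole box.
      have e1 : ∑ n ∈ box, D j n * ‖w n‖ ^ 2 - E j =
          ∑ n ∈ lo, D j n * ‖w n‖ ^ 2 + centredSum hi (α j) g +
            (∑ n ∈ box, α j n - E j) - ∑ n ∈ lo, α j n := by
        have a1 := Finset.sum_filter_add_sum_filter_not box (fun n => jb n ^ 2 ≤ √p)
          (fun n => D j n * ‖w n‖ ^ 2)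
        have a2 := Finset.sum_filter_add_sum_filter_not box (fun n => jb n ^ 2 ≤ √p) (α j)
        have a3 : ∑ n ∈ hi, D j n * ‖w n‖ ^ 2 = centredSum hi (α j) g + ∑ n ∈ hi, α j n := by
          rw [centredSum, ← Finset.sum_add_distrib]
          refine Finset.sum_congr rfl fun n _ => ?_
          rw [hw, norm_sq_symbolMul_gaussianCoeff]
          simp only [α]; ring
        rw [← a1, ← a2]
        change _ + ∑ n ∈ hi, D j n * ‖w n‖ ^ 2 - _ = _
        rw [a3]
        ring
      have b1 : |∑ n ∈ lo, D j n * ‖w n‖ ^ 2| ≤ K j * (√p * 2 ^ s * R ^ 2) := by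
        calc _ ≤ ∑ n ∈ lo, |D j n * ‖w n‖ ^ 2| := Finset.abs_sum_le_sum_abs _ _
          _ ≤ ∑ n ∈ lo, K j * (jb n ^ (2 * s - 2) * ‖w n‖ ^ 2) := by
              refine Finset.sum_le_sum fun n hn => ?_
              rw [abs_mul, abs_of_nonneg (sq_nonneg ‖w n‖), ← mul_assoc]
              gcongr
              exact hD j hj n (Finset.mem_filter.mp hn).1
          _ ≤ _ := by
              rw [← Finset.mul_sum]
              gcongr
              exact low_sum_le hs hσ (by linarith) hball lo hsp.le
                fun n hn => (Finset.mem_filter.mp hn).2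
      -- On `lo` one has `⟨n⟩^(-2) ≤ √p ⟨n⟩^(-4)`, which is summable in dimension three.
      have b2 : |∑ n ∈ lo, α j n| ≤ K j * (c * S4 * √p) := by
        calc _ ≤ ∑ n ∈ lo, |α j n| := Finset.abs_sum_le_sum_abs _ _
          _ ≤ ∑ n ∈ lo, K j * c * √p * (jb n ^ (-2 : ℝ)) ^ 2 := by
              refine Finset.sum_le_sum fun n hn => ?_
              obtain ⟨hn1, hn2⟩ := Finset.mem_filter.mp hn
              refine (hα j hj n hn1).trans ?_
              have hj := jb_pos n
              rw [mul_assoc (K j * c)]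
              refine mul_le_mul_of_nonneg_left ?_ (by positivity)
              rw [hm2, sq (jb n ^ 2)⁻¹, ← mul_assoc]
              refine le_mul_of_one_le_left (by positivity) ?_
              rw [← div_eq_mul_inv, one_le_div (by positivity)]
              exact hn2
          _ ≤ K j * c * √p * S4 := by
              rw [← Finset.mul_sum]; gcongr; exact hS4le lo
          _ = _ := by ring
      have b3 := hE j hj
      have hR2 : 1 ≤ R ^ 2 := one_le_pow₀ hR
      rw [e1]
      calc _ ≤ |∑ n ∈ lo, D j n * ‖w n‖ ^ 2| + |centredSum hi (α j) g| +
            |∑ n ∈ box, α j n - E j| + |∑ n ∈ lo, α j n| := by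
            refine (abs_sub _ _).trans ?_
            gcongr
            refine (abs_add_le _ _).trans ?_
            gcongr
            exact abs_add_le _ _
        _ ≤ K j * (√p * 2 ^ s * R ^ 2) + |centredSum hi (α j) g| + K j +
            K j * (c * S4 * √p) := by gcongr
        _ ≤ K j * (√p * 2 ^ s * R ^ 2) + |centredSum hi (α j) g| + K j * (√p * R ^ 2) +
            K j * (c * S4 * √p * R ^ 2) := by
            have a1 : K j ≤ K j * (√p * R ^ 2) :=
              le_mul_of_one_le_right hKj.le (one_le_mul_of_one_le_of_one_le hsp1 hR2)
            have a2 : K j * (c * S4 * √p) ≤ K j * (c * S4 * √p * R ^ 2) :=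
              mul_le_mul_of_nonneg_left (le_mul_of_one_le_right (by positivity) hR2) hKj.le
            linarith
        _ = _ := by rw [hc1]; ring
    -- The cancellation `h0` is used while the weights still carry their signs.
    calc |∑ j ∈ J, L j w * ∑ n ∈ box, D j n * ‖w n‖ ^ 2|
        = |∑ j ∈ J, L j w * (∑ n ∈ box, D j n * ‖w n‖ ^ 2 - E j)| := by
          simp only [mul_sub, Finset.sum_sub_distrib, h0, sub_zero]
      _ ≤ ∑ j ∈ J, |L j w * (∑ n ∈ box, D j n * ‖w n‖ ^ 2 - E j)| :=
          Finset.abs_sum_le_sum_abs _ _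
      _ ≤ ∑ j ∈ J, (R ^ 8 * κ j) * (K j * (c1 * √p * R ^ 2) + |centredSum hi (α j) g|) := by
          refine Finset.sum_le_sum fun j hj => ?_
          rw [abs_mul]
          have := hκ j hj
          exact mul_le_mul (hL j hj w hball) (hX j hj) (abs_nonneg _) (by positivity)
      _ = _ := by
          simp only [mul_add, Finset.sum_add_distrib, Finset.sum_mul]
          congr 1
          exact Finset.sum_congr rfl fun j _ => by ring
  have hκK : 0 ≤ ∑ j ∈ J, κ j * K j :=
    Finset.sum_nonneg fun j hj => mul_nonneg (hκ j hj) (hK j hj).le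
  refine (eLpNorm_le_of_abs_le_add_sum (by simpa using hp) J
    (B := fun j => 8 * (K j * c * (1 + S4)) * √p) (by positivity)
    (fun j hj => mul_nonneg (by positivity) (hκ j hj))
    (fun j hj => by have := hK j hj; positivity)
    (fun j _ => measurable_centredSum hi (α j)) hY hpt).trans (ENNReal.ofReal_le_ofReal ?_)
  have e : ∑ j ∈ J, R ^ 8 * κ j * (8 * (K j * c * (1 + S4)) * √p) =
      (∑ j ∈ J, κ j * K j) * (8 * (c * (1 + S4)) * √p * R ^ 8) := by
    rw [Finset.sum_mul]
    exact Finset.sum_congr rfl fun j _ => by ring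
  rw [e]
  have hR8 : R ^ 8 ≤ R ^ 10 := pow_le_pow_right₀ hR (by norm_num)
  calc _ ≤ (∑ j ∈ J, κ j * K j) * (c1 * √p * R ^ 10) +
        (∑ j ∈ J, κ j * K j) * (8 * (c * (1 + S4)) * √p * R ^ 10) := by gcongr
    _ = (∑ j ∈ J, κ j * K j) * ((c1 + 8 * (c * (1 + S4))) * √p * R ^ 10) := by ring
    _ ≤ Q * ((c1 + 8 * (c * (1 + S4))) * √p * R ^ 10) := by gcongr
    _ = _ := by ring

/-! ### Comparability of the two high frequencies -/

/-- With `u`, `v` the cube roots of `1 + r₁`, `1 + r₂`, the condition `θ < 1/3` gives `u³ - v³ ≤ l ≤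
u + v`. This forces `u ≤ 2v` and, symmetrically, `v ≤ 2u`; hence the ratio `8` and `l ≤ 3v`. -/
lemma high_comparable {r₁ r₂ l θ : ℝ} (h1 : 0 ≤ r₁) (h2 : 0 ≤ r₂) (hθ₀ : 0 < θ) (hθ : θ < 1 / 3)
    (hd : |r₁ - r₂| ≤ l) (hl : l ≤ r₁ ^ θ + r₂ ^ θ) :
    1 + r₁ ≤ 8 * (1 + r₂) ∧ 1 + r₂ ≤ 8 * (1 + r₁) ∧
      l ^ 2 ≤ 16 * (1 + r₂) ^ (2 / 3 : ℝ) ∧ l ≤ 4 * (1 + r₂) := by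
  have hpow : ∀ r : ℝ, 0 ≤ r → r ^ θ ≤ (1 + r) ^ (1 / 3 : ℝ) := fun r hr =>
    (Real.rpow_le_rpow hr (by linarith) hθ₀.le).trans
      (Real.rpow_le_rpow_of_exponent_le (by linarith) hθ.le)
  have hcube : ∀ r : ℝ, 0 ≤ r → ((1 + r) ^ (1 / 3 : ℝ)) ^ 3 = 1 + r := fun r hr => by
    rw [← Real.rpow_natCast, ← Real.rpow_mul (by linarith)]; norm_num
  obtain ⟨hd1, hd2⟩ := abs_le.mp hd
  have key : ∀ u v : ℝ, 1 ≤ u → 1 ≤ v → u ^ 3 - v ^ 3 ≤ u + v → u ≤ 2 * v := by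
    intro u v hu hv h
    by_contra hc
    push Not at hc
    nlinarith [mul_pos (by linarith : 0 < u) (by linarith : 0 < v), sq_nonneg (u - v),
      mul_pos (mul_pos (by linarith : 0 < u) (by linarith : 0 < v)) (by linarith : 0 < v),
      sq_nonneg u, sq_nonneg v, mul_nonneg (by linarith : 0 ≤ u - 2 * v) (sq_nonneg u),
      mul_nonneg (by linarith : 0 ≤ u - 1) (by linarith : 0 ≤ u + 1)]
  set u := (1 + r₁) ^ (1 / 3 : ℝ) with hu
  set v := (1 + r₂) ^ (1 / 3 : ℝ) with hv
  have hu1 : 1 ≤ u := Real.one_le_rpow (by linarith) (by norm_num)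
  have hv1 : 1 ≤ v := Real.one_le_rpow (by linarith) (by norm_num)
  have hlu : l ≤ u + v := hl.trans (add_le_add (hpow _ h1) (hpow _ h2))
  have cu := hcube _ h1
  have cv := hcube _ h2
  rw [← hu] at cu
  rw [← hv] at cv
  have k1 := key u v hu1 hv1 (by rw [cu, cv]; linarith)
  have k2 := key v u hv1 hu1 (by rw [cu, cv]; linarith)
  have hl0 : 0 ≤ l := (abs_nonneg _).trans hd
  have hl3 : l ≤ 3 * v := by linarith
  have hv2 : v ^ 2 = (1 + r₂) ^ (2 / 3 : ℝ) := by
    rw [hv, ← Real.rpow_natCast, ← Real.rpow_mul (by linarith)]; norm_num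
  refine ⟨?_, ?_, ?_, ?_⟩
  · rw [← cu, ← cv]
    calc u ^ 3 ≤ (2 * v) ^ 3 := pow_le_pow_left₀ (by linarith) k1 3
      _ = _ := by ring
  · rw [← cu, ← cv]
    calc v ^ 3 ≤ (2 * u) ^ 3 := pow_le_pow_left₀ (by linarith) k2 3
      _ = _ := by ring
  · rw [← hv2]; nlinarith
  · rw [← cv]
    nlinarith [mul_nonneg (by linarith : 0 ≤ v - 1) (by linarith : 0 ≤ v + 1),
      mul_nonneg (mul_nonneg (by linarith : 0 ≤ v - 1) (by linarith : 0 ≤ v + 1))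
        (by linarith : 0 ≤ v)]

/-! ### Power differences -/

lemma abs_rpow_sub_rpow_le {s x y m : ℝ} (hs : 1 ≤ s) (hx : 0 ≤ x) (hy : 0 ≤ y) (hxm : x ≤ m)
    (hym : y ≤ m) : |x ^ s - y ^ s| ≤ s * m ^ (s - 1) * |x - y| := by
  have h := (convex_Icc (0 : ℝ) m).norm_image_sub_le_of_norm_hasDerivWithin_le
    (f := fun t : ℝ => t ^ s) (f' := fun t => s * t ^ (s - 1)) (C := s * m ^ (s - 1))
    (fun t ht => (Real.hasDerivAt_rpow_const (Or.inr hs)).hasDerivWithinAt)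
    (fun t ht => by
      have := Real.rpow_nonneg ht.1 (s - 1)
      rw [Real.norm_eq_abs, abs_of_nonneg (by positivity)]
      gcongr
      · exact ht.1
      · exact ht.2)
    (⟨hy, hym⟩ : y ∈ Set.Icc 0 m) (⟨hx, hxm⟩ : x ∈ Set.Icc 0 m)
  simpa [Real.norm_eq_abs] using h

lemma rpow_two_mul {r s : ℝ} (hr : 0 ≤ r) : r ^ (2 * s) = (r ^ 2) ^ s := by
  rw [Real.rpow_mul hr]; norm_cast

/-- Mean value theorem for `t ↦ t ^ s` at the squares, so that the difference of squares, the
leading part of the resonance function, factors out. -/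
lemma abs_rpow_two_mul_sub_le {s r₁ r₂ m : ℝ} (hs : 1 ≤ s) (h1 : 0 ≤ r₁) (h2 : 0 ≤ r₂)
    (h1m : r₁ ≤ m) (h2m : r₂ ≤ m) :
    |r₁ ^ (2 * s) - r₂ ^ (2 * s)| ≤ s * m ^ (2 * s - 2) * |r₁ ^ 2 - r₂ ^ 2| := by
  have hm : 0 ≤ m := h1.trans h1m
  rw [rpow_two_mul h1, rpow_two_mul h2, show 2 * s - 2 = 2 * (s - 1) by ring, rpow_two_mul hm]
  exact abs_rpow_sub_rpow_le hs (by positivity) (by positivity)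
    (pow_le_pow_left₀ h1 h1m 2) (pow_le_pow_left₀ h2 h2m 2)

lemma rpow_two_mul_le {s r m : ℝ} (hs : 1 ≤ s) (h : 0 ≤ r) (hm : r ≤ m) :
    r ^ (2 * s) ≤ m ^ (2 * s - 2) * r ^ 2 := by
  rcases h.eq_or_lt with rfl | h0
  · rw [Real.zero_rpow (by linarith)]; simp
  · have : r ^ (2 * s) = r ^ (2 * s - 2) * r ^ 2 := by
      rw [← Real.rpow_natCast r 2, ← Real.rpow_add h0]; congr 1; push_cast; ring
    rw [this]
    gcongr
    linarith

lemma add_rpow_two_mul_add_le {s r₁ r₂ m : ℝ} (hs : 1 ≤ s) (h1 : 0 ≤ r₁) (h2 : 0 ≤ r₂)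
    (h1m : r₁ ≤ m) (h2m : r₂ ≤ m) :
    r₁ ^ (2 * s) + r₂ ^ (2 * s) ≤ m ^ (2 * s - 2) * (r₁ ^ 2 + r₂ ^ 2) := by
  rw [mul_add]
  exact add_le_add (rpow_two_mul_le hs h1 h1m) (rpow_two_mul_le hs h2 h2m)

/-- The total size of a quadruple of low frequencies. -/
def lowSum (a : Fin 4 → Freq) : ℝ := ∑ i, freqNorm (a i)

lemma lowSum_nonneg (a : Fin 4 → Freq) : 0 ≤ lowSum a :=
  Finset.sum_nonneg fun _ _ => freqNorm_nonneg _

lemma freqNorm_le_lowSum (a : Fin 4 → Freq) (i : Fin 4) : freqNorm (a i) ≤ lowSum a :=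
  Finset.single_le_sum (f := fun i => freqNorm (a i)) (fun _ _ => freqNorm_nonneg _)
    (Finset.mem_univ i)

lemma sum_sq_le_lowSum_sq (a : Fin 4 → Freq) : ∑ i, freqNorm (a i) ^ 2 ≤ lowSum a ^ 2 :=
  Finset.sum_sq_le_sq_sum_of_nonneg fun _ _ => freqNorm_nonneg _

lemma abs_signed_sum_le (a : Fin 4 → Freq) {e : Fin 4 → ℝ} (he : ∀ i, |e i| = 1) (f : Freq → ℝ)
    (hf : ∀ k, 0 ≤ f k) : |∑ i, e i * f (a i)| ≤ ∑ i, f (a i) := by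
  refine (Finset.abs_sum_le_sum_abs _ _).trans (Finset.sum_le_sum fun i _ => ?_)
  rw [abs_mul, he, one_mul, abs_of_nonneg (hf _)]

lemma sum_rpow_le_lowSum {s m : ℝ} (hs : 1 ≤ s) (a : Fin 4 → Freq) (hm : lowSum a ≤ m) :
    ∑ i, freqNorm (a i) ^ (2 * s) ≤ m ^ (2 * s - 2) * lowSum a ^ 2 := by
  have hm0 : 0 ≤ m := (lowSum_nonneg a).trans hm
  calc _ ≤ ∑ i, m ^ (2 * s - 2) * freqNorm (a i) ^ 2 :=
        Finset.sum_le_sum fun i _ => rpow_two_mul_le hs (freqNorm_nonneg _)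
          ((freqNorm_le_lowSum a i).trans hm)
    _ ≤ _ := by
        rw [← Finset.mul_sum]
        gcongr
        exact sum_sq_le_lowSum_sq a

/-! ### The weight -/

/-- The resonance function is integer valued, so division by it never loses. -/
lemma resonance_eq_zero_or_one_le (k : Fin 6 → Freq) :
    resonance k = 0 ∨ 1 ≤ |resonance k| := by
  have h : resonance k = ((∑ j : Fin 6, (-1) ^ (j : ℕ) * ∑ i, k j i ^ 2 : ℤ) : ℝ) := by
    rw [resonance]
    simp only [freqNorm_sq]
    push_cast
    rfl
  rw [h]
  generalize (∑ j : Fin 6, (-1) ^ (j : ℕ) * ∑ i, k j i ^ 2 : ℤ) = z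
  by_cases hz : z = 0
  · left; simp [hz]
  · right
    have := Int.one_le_abs hz
    exact_mod_cast this

/-- Here `A`, `B` are the high-frequency parts of denominator and numerator, `α`, `β` the
low-frequency corrections, and `φ` the cutoff away from resonance. Integrality of `A + α` gives the
crude bounds. The third bound is the gain: the error is `O(q / |A|)` relative to them, trivially for
small `|A|`, and through the exact difference of quotients for large `|A|`. -/
lemma quotient_perturbation {Cη c P q l A B α β φ : ℝ} (hCη : 1 ≤ Cη) (hc : 0 ≤ c) (hP : 0 ≤ P)
    (hq : 1 ≤ q) (hl : 0 ≤ l) (hlq : l ^ 2 ≤ 16 * q) (hB : |B| ≤ c * P * |A|) (hα : |α| ≤ l ^ 2)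
    (hβ : |β| ≤ c * P * l ^ 2) (hint : A + α = 0 ∨ 1 ≤ |A + α|) (hφ : |φ| ≤ Cη)
    (hφ1 : A + α ≠ 0 → 6 * q ≤ |A + α| → φ = 1) :
    |φ * ((B + β) / (A + α))| ≤ 200 * Cη * c * (1 + l) ^ 2 * P ∧
      |φ * ((B + β) / (A + α)) - B / A| ≤ 200 * Cη * c * (1 + l) ^ 2 * P ∧
      |φ * ((B + β) / (A + α)) - B / A| * |A| ≤ 200 * Cη * c * (1 + l) ^ 2 * P * q := by
  have hcP : 0 ≤ c * P := mul_nonneg hc hP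
  have hA : |A| ≤ |A + α| + l ^ 2 := by
    calc |A| = |(A + α) - α| := by ring_nf
      _ ≤ |A + α| + |α| := abs_sub _ _
      _ ≤ _ := by gcongr
  have hl2 : 1 + 2 * l ^ 2 ≤ 2 * (1 + l) ^ 2 := by nlinarith
  have hl1 : 1 ≤ (1 + l) ^ 2 := by nlinarith
  have hm : |φ * ((B + β) / (A + α))| ≤ 2 * Cη * (c * P) * (1 + l) ^ 2 := by
    rcases hint with h | h
    · rw [h, div_zero, mul_zero, abs_zero]; positivity
    · have hpos : 0 < |A + α| := by linarith
      rw [abs_mul, abs_div]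
      have : |B + β| / |A + α| ≤ c * P * (2 * (1 + l) ^ 2) := by
        rw [div_le_iff₀ hpos]
        calc |B + β| ≤ |B| + |β| := abs_add_le _ _
          _ ≤ c * P * |A| + c * P * l ^ 2 := add_le_add hB hβ
          _ ≤ c * P * (|A + α| + l ^ 2) + c * P * l ^ 2 := by gcongr
          _ = c * P * (|A + α| + 2 * l ^ 2 * 1) := by ring
          _ ≤ c * P * (|A + α| + 2 * l ^ 2 * |A + α|) := by gcongr
          _ = c * P * ((1 + 2 * l ^ 2) * |A + α|) := by ring
          _ ≤ c * P * (2 * (1 + l) ^ 2 * |A + α|) := by gcongr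
          _ = _ := by ring
      calc _ ≤ Cη * (c * P * (2 * (1 + l) ^ 2)) := by gcongr
        _ = _ := by ring
  have hBA : |B / A| ≤ Cη * (c * P) * (1 + l) ^ 2 := by
    have h1 : |B / A| ≤ c * P := by
      rw [abs_div]
      exact div_le_of_le_mul₀ (abs_nonneg _) hcP hB
    refine h1.trans ?_
    calc c * P = 1 * (c * P) * 1 := by ring
      _ ≤ _ := by gcongr
  have hd : |φ * ((B + β) / (A + α)) - B / A| ≤ 3 * Cη * (c * P) * (1 + l) ^ 2 := by
    refine (abs_sub _ _).trans ?_
    linarith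
  have hbase : 0 ≤ Cη * (c * P) * (1 + l) ^ 2 := by positivity
  refine ⟨by linarith, by linarith, ?_⟩
  -- Since `|α| ≤ 16 q`, being above `38 q` ensures both `|A| ≤ 2 |A + α|` and `|A + α| ≥ 6 q`, so
  -- that the cutoff equals one.
  by_cases hAq : |A| ≤ 38 * q
  · calc _ ≤ (3 * Cη * (c * P) * (1 + l) ^ 2) * (38 * q) := by gcongr
      _ = 114 * (Cη * (c * P) * (1 + l) ^ 2 * q) := by ring
      _ ≤ 200 * (Cη * (c * P) * (1 + l) ^ 2 * q) := by gcongr; norm_num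
      _ = _ := by ring
  · push Not at hAq
    have hΩ : |A| ≤ 2 * |A + α| := by linarith
    have hΩ6 : 6 * q ≤ |A + α| := by linarith
    have hApos : 0 < |A| := by linarith
    have hΩpos : 0 < |A + α| := by linarith
    have hA0 : A ≠ 0 := abs_pos.mp hApos
    have hΩ0 : A + α ≠ 0 := abs_pos.mp hΩpos
    rw [hφ1 hΩ0 hΩ6, one_mul]
    have e : (B + β) / (A + α) - B / A = (β * A - α * B) / ((A + α) * A) := by
      field_simp; ring
    rw [e, abs_div, abs_mul, div_mul_eq_mul_div, mul_div_mul_right _ _ hApos.ne',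
      div_le_iff₀ hΩpos]
    calc |β * A - α * B| ≤ |β| * |A| + |α| * |B| := by
          rw [← abs_mul, ← abs_mul]; exact abs_sub _ _
      _ ≤ c * P * l ^ 2 * |A| + l ^ 2 * (c * P * |A|) := by gcongr
      _ = c * P * l ^ 2 * (2 * |A|) := by ring
      _ ≤ c * P * (1 + l) ^ 2 * (2 * (2 * |A + α|)) := by gcongr; linarith
      _ = 4 * 1 * (c * P) * (1 + l) ^ 2 * 1 * |A + α| := by ring
      _ ≤ 200 * Cη * (c * P) * (1 + l) ^ 2 * q * |A + α| := by gcongr; norm_num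
      _ = _ := by ring

/-- The weight is comparable with the quotient of its two high-frequency parts. -/
lemma weight_estimates {η : ℝ → ℝ} (hη : IsBump η) {Cη s δ₀ : ℝ} (hCη : ∀ x, |1 - η x| ≤ Cη)
    (hs : 1 ≤ s) (hδ0 : 0 ≤ δ₀) (hδ : δ₀ ≤ 2 / 3) {k : Fin 6 → Freq} {a : Fin 4 → Freq}
    {e : Fin 4 → ℝ} (he : ∀ i, |e i| = 1) {x y : Freq} {ε A B : ℝ} (hε : |ε| = 1)
    (hΩ : resonance k = ε * (A + ∑ i, e i * freqNorm (a i) ^ 2))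
    (hψ : psi s k = ε * (B + ∑ i, e i * freqNorm (a i) ^ (2 * s)))
    (hlam : lam k ^ 2 = freqNorm x ^ 2 + freqNorm y ^ 2 + ∑ i, freqNorm (a i) ^ 2)
    (hxy : jb x ≤ 8 * jb y) (hl : lowSum a ^ 2 ≤ 16 * jb y ^ (2 / 3 : ℝ))
    (hl' : lowSum a ≤ 4 * jb y) (hB : |B| ≤ s * (8 * jb y) ^ (2 * s - 2) * |A|) :
    |weight η s δ₀ k| ≤
        200 * Cη * (s * 8 ^ (2 * s - 2)) * (1 + lowSum a) ^ 2 * jb y ^ (2 * s - 2) ∧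
      |weight η s δ₀ k - B / A| ≤
        200 * Cη * (s * 8 ^ (2 * s - 2)) * (1 + lowSum a) ^ 2 * jb y ^ (2 * s - 2) ∧
      |weight η s δ₀ k - B / A| * |A| ≤
        200 * Cη * (s * 8 ^ (2 * s - 2)) * (1 + lowSum a) ^ 2 * jb y ^ (2 * s - 2) *
          jb y ^ (2 / 3 : ℝ) := by
  have hjy := jb_pos y
  have hε0 : ε ≠ 0 := by intro h; simp [h] at hε
  have h8 : (8 * jb y) ^ (2 * s - 2) = 8 ^ (2 * s - 2) * jb y ^ (2 * s - 2) :=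
    Real.mul_rpow (by norm_num) hjy.le
  have hηout : ∀ t : ℝ, 1 ≤ |t| → η t = 0 := by
    intro t ht
    by_contra h
    have := hη.support_subset (subset_tsupport η h)
    rw [Set.mem_Ioo, ← abs_lt] at this
    linarith
  have hCη1 : 1 ≤ Cη := by
    have := hCη 1
    rw [hηout 1 (by simp)] at this
    simpa using this
  have hΩabs : |resonance k| = |A + ∑ i, e i * freqNorm (a i) ^ 2| := by
    rw [hΩ, abs_mul, hε, one_mul]
  have hlam0 : 0 ≤ lam k := Real.sqrt_nonneg _
  have hx : freqNorm x ≤ 8 * jb y := (freqNorm_le_jb x).trans hxy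
  have hlamle : lam k ≤ 13 * jb y := by
    have h1 := sum_sq_le_lowSum_sq a
    have h2 := freqNorm_le_jb y
    have h3 := freqNorm_nonneg x
    have h4 := freqNorm_nonneg y
    have h5 := lowSum_nonneg a
    refine abs_le_of_sq_le_sq' ?_ (by positivity) |>.2
    rw [hlam]
    nlinarith [mul_self_le_mul_self h3 hx, mul_self_le_mul_self h4 h2,
      mul_self_le_mul_self h5 hl']
  -- This is the source of the threshold `6 q` in `quotient_perturbation`: `13² ≤ 6³`, and `δ₀ ≤
  -- 2/3`.
  have hlamδ : lam k ^ δ₀ ≤ 6 * jb y ^ (2 / 3 : ℝ) := by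
    have hb : 1 ≤ 13 * jb y := by linarith [one_le_jb y]
    calc lam k ^ δ₀ ≤ (13 * jb y) ^ δ₀ := Real.rpow_le_rpow hlam0 hlamle hδ0
      _ ≤ (13 * jb y) ^ (2 / 3 : ℝ) := Real.rpow_le_rpow_of_exponent_le hb hδ
      _ = 13 ^ (2 / 3 : ℝ) * jb y ^ (2 / 3 : ℝ) := Real.mul_rpow (by norm_num) hjy.le
      _ ≤ _ := by
        gcongr
        calc (13 : ℝ) ^ (2 / 3 : ℝ) = ((13 : ℝ) ^ (2 : ℝ)) ^ (1 / 3 : ℝ) := by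
              rw [← Real.rpow_mul (by norm_num)]; norm_num
          _ ≤ ((6 : ℝ) ^ (3 : ℝ)) ^ (1 / 3 : ℝ) := by
              gcongr; norm_num
          _ = 6 := by rw [← Real.rpow_mul (by norm_num)]; norm_num
  have hq : 1 ≤ jb y ^ (2 / 3 : ℝ) := Real.one_le_rpow (one_le_jb y) (by norm_num)
  have hw : weight η s δ₀ k = (1 - η (resonance k / lam k ^ δ₀)) *
      ((B + ∑ i, e i * freqNorm (a i) ^ (2 * s)) / (A + ∑ i, e i * freqNorm (a i) ^ 2)) := by
    rw [weight, hψ]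
    congr 1
    rw [hΩ, mul_div_mul_left _ _ hε0]
  rw [hw]
  refine quotient_perturbation (P := jb y ^ (2 * s - 2)) hCη1 (by positivity) (by positivity) hq
    (lowSum_nonneg a) hl ?_ ?_ ?_ ?_ (hCη _) ?_
  · rw [mul_assoc s, ← h8]; exact hB
  · exact (abs_signed_sum_le a he (fun k => freqNorm k ^ 2) fun _ => sq_nonneg _).trans
      (sum_sq_le_lowSum_sq a)
  · refine (abs_signed_sum_le a he (fun k => freqNorm k ^ (2 * s))
      fun _ => Real.rpow_nonneg (freqNorm_nonneg _) _).trans ?_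
    refine (sum_rpow_le_lowSum hs a (hl'.trans (by linarith : 4 * jb y ≤ 8 * jb y))).trans ?_
    rw [mul_assoc s, ← h8]
    have : 0 ≤ (8 * jb y) ^ (2 * s - 2) := by positivity
    gcongr
    exact le_mul_of_one_le_left this hs
  · rw [← hΩabs]
    rcases resonance_eq_zero_or_one_le k with h | h
    · left
      rw [h] at hΩ
      simpa [hε0] using hΩ.symm
    · right; exact h
  · intro h0 h6
    rw [← hΩabs] at h6
    -- If `lam k` vanished, so would all frequencies and the resonance function, against `h6`.
    have hlampos : 0 < lam k := by
      rcases hlam0.lt_or_eq with h | h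
      · exact h
      · exfalso
        have h7 : ∀ j, freqNorm (k j) ^ 2 = 0 := by
          have h9 : ∑ j : Fin 6, freqNorm (k j) ^ 2 = 0 :=
            (Real.sqrt_eq_zero (Finset.sum_nonneg fun _ _ => sq_nonneg _)).mp h.symm
          intro j
          exact (Finset.sum_eq_zero_iff_of_nonneg fun _ _ => sq_nonneg _).mp h9 j
            (Finset.mem_univ j)
        have : resonance k = 0 := by simp [resonance, h7]
        rw [this] at h6
        simp at h6
        linarith
    have hpos : 0 < lam k ^ δ₀ := Real.rpow_pos_of_pos hlampos _
    rw [hηout, sub_zero]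
    rw [abs_div, abs_of_pos hpos, one_le_div hpos]
    linarith

/-! ### The three configurations of frequencies -/

/-- High frequencies in the first two slots. -/
def tupleDiff (x y : Freq) (a : Fin 4 → Freq) : Fin 6 → Freq := ![x, y, a 0, a 1, a 2, a 3]

/-- High frequencies in the first and third slots. -/
def tupleOdd (x y : Freq) (a : Fin 4 → Freq) : Fin 6 → Freq := ![x, a 0, y, a 1, a 2, a 3]

/-- High frequencies in the second and fourth slots. -/
def tupleEven (x y : Freq) (a : Fin 4 → Freq) : Fin 6 → Freq := ![a 0, x, a 1, y, a 3, a 2]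

lemma sum_signed_six (f : Fin 6 → ℝ) : ∑ j : Fin 6, (-1 : ℝ) ^ (j : ℕ) * f j =
    f 0 - f 1 + f 2 - f 3 + f 4 - f 5 := by
  simp only [Fin.sum_univ_succ, Fin.sum_univ_zero]
  simp [Fin.succ, pow_succ]
  ring

/-- The quotient `(|x|^{2s} - |y|^{2s}) / (|x|² - |y|²)`. -/
def diffSymbol (s : ℝ) (x y : Freq) : ℝ :=
  (freqNorm x ^ (2 * s) - freqNorm y ^ (2 * s)) / (freqNorm x ^ 2 - freqNorm y ^ 2)

/-- The quotient `(|x|^{2s} + |y|^{2s}) / (|x|² + |y|²)`. -/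
def addSymbol (s : ℝ) (x y : Freq) : ℝ :=
  (freqNorm x ^ (2 * s) + freqNorm y ^ (2 * s)) / (freqNorm x ^ 2 + freqNorm y ^ 2)

lemma diffSymbol_comm (s : ℝ) (x y : Freq) : diffSymbol s x y = diffSymbol s y x := by
  rw [diffSymbol, diffSymbol, ← neg_sub (freqNorm y ^ (2 * s)), ← neg_sub (freqNorm y ^ 2),
    neg_div_neg_eq]

/-- A difference of reciprocals is the difference of the powers times the product of the variances.
The factor `|x|² - |y|²` produced here is the `|A|` absorbed by the third bound of
`weight_estimates`. -/
lemma coeffVar_mul_coeffVar_le {s : ℝ} (hs : 1 ≤ s) {x y : Freq} (hxy : jb x ≤ 8 * jb y)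
    (hyx : jb y ≤ 8 * jb x) :
    |coeffVar s y - coeffVar s x| ≤ (s * 8 ^ (2 * s - 2) * 2 ^ (4 * s) * 8 ^ (2 * s)) *
      jb y ^ (-(2 * s) - 2) * |freqNorm x ^ 2 - freqNorm y ^ 2| := by
  have hx := jb_pos x
  have hy := jb_pos y
  have hpx : 0 < 1 + freqNorm x ^ (2 * s) := by
    have := Real.rpow_nonneg (freqNorm_nonneg x) (2 * s); positivity
  have hpy : 0 < 1 + freqNorm y ^ (2 * s) := by
    have := Real.rpow_nonneg (freqNorm_nonneg y) (2 * s); positivity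
  have e1 : coeffVar s y - coeffVar s x =
      (freqNorm x ^ (2 * s) - freqNorm y ^ (2 * s)) * (coeffVar s y * coeffVar s x) := by
    rw [coeffVar, coeffVar]; field_simp; ring
  have h1 := abs_rpow_two_mul_sub_le (m := 8 * jb y) hs (freqNorm_nonneg x) (freqNorm_nonneg y)
    ((freqNorm_le_jb x).trans hxy) ((freqNorm_le_jb y).trans (by linarith))
  have h2 := coeffVar_le (s := s) (by linarith) x
  have h3 := coeffVar_le (s := s) (by linarith) y
  have h4 : jb x ^ (-(2 * s)) ≤ 8 ^ (2 * s) * jb y ^ (-(2 * s)) := by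
    calc jb x ^ (-(2 * s)) ≤ (jb y / 8) ^ (-(2 * s)) :=
          Real.rpow_le_rpow_of_nonpos (by positivity) (by linarith) (by linarith)
      _ = _ := by
          rw [Real.div_rpow hy.le (by norm_num), Real.rpow_neg (by norm_num : (0 : ℝ) ≤ 8),
            div_inv_eq_mul, mul_comm]
  rw [Real.mul_rpow (by norm_num) hy.le] at h1
  have c1 := coeffVar_pos s x
  have c2 := coeffVar_pos s y
  rw [e1, abs_mul, abs_of_pos (mul_pos c2 c1)]
  calc _ ≤ (s * (8 ^ (2 * s - 2) * jb y ^ (2 * s - 2)) * |freqNorm x ^ 2 - freqNorm y ^ 2|) *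
        ((2 ^ (2 * s) * jb y ^ (-(2 * s))) *
          (2 ^ (2 * s) * (8 ^ (2 * s) * jb y ^ (-(2 * s))))) := by
        gcongr
        exact h2.trans (by gcongr)
    _ = s * 8 ^ (2 * s - 2) * ((2 : ℝ) ^ (2 * s) * 2 ^ (2 * s)) * 8 ^ (2 * s) *
        (jb y ^ (2 * s - 2) * jb y ^ (-(2 * s)) * jb y ^ (-(2 * s))) *
          |freqNorm x ^ 2 - freqNorm y ^ 2| := by ring
    _ = _ := by
        rw [← Real.rpow_add (by norm_num), ← Real.rpow_add hy, ← Real.rpow_add hy]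
        ring_nf

lemma jb_rpow_comparable {s : ℝ} (hs : 1 ≤ s) {x y : Freq} (hyx : jb y ≤ 8 * jb x) :
    jb y ^ (2 * s - 2) ≤ 8 ^ (2 * s - 2) * jb x ^ (2 * s - 2) := by
  rw [← Real.mul_rpow (by norm_num) (jb_pos x).le]
  exact Real.rpow_le_rpow (jb_pos y).le hyx (by linarith)

lemma IsBump.exists_bound {η : ℝ → ℝ} (hη : IsBump η) : ∃ C, 0 < C ∧ ∀ x, |1 - η x| ≤ C := by
  have hc : HasCompactSupport η :=
    (isCompact_Icc (a := (-1 : ℝ)) (b := 1)).of_isClosed_subset (isClosed_tsupport η)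
      (hη.support_subset.trans Set.Ioo_subset_Icc_self)
  obtain ⟨C, hC⟩ := hc.exists_bound_of_continuous hη.smooth.continuous
  have hC0 : 0 ≤ C := (norm_nonneg _).trans (hC 0)
  refine ⟨1 + C, by linarith, fun x => (abs_sub _ _).trans ?_⟩
  have := hC x
  rw [Real.norm_eq_abs] at this
  simpa using this

/-- The size bound is needed with both brackets, since the paired high frequency is `y` in `S11` and
`x` in `S21`. -/
theorem weight_tupleDiff_estimates {η : ℝ → ℝ} (hη : IsBump η) {s θ δ₀ : ℝ} (hs : 1 ≤ s)
    (hθ₀ : 0 < θ) (hθ : θ < 1 / 3) (hδ0 : 0 ≤ δ₀) (hδ : δ₀ ≤ 2 / 3) :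
    ∃ C : ℝ, 0 < C ∧ ∀ (x y : Freq) (a : Fin 4 → Freq), |freqNorm x - freqNorm y| ≤ lowSum a →
      lowSum a ≤ freqNorm x ^ θ + freqNorm y ^ θ →
      |weight η s δ₀ (tupleDiff x y a)| ≤ C * (1 + lowSum a) ^ 2 * jb y ^ (2 * s - 2) ∧
      |weight η s δ₀ (tupleDiff x y a)| ≤ C * (1 + lowSum a) ^ 2 * jb x ^ (2 * s - 2) ∧
      |weight η s δ₀ (tupleDiff x y a) - diffSymbol s x y| * |coeffVar s y - coeffVar s x| ≤
        C * (1 + lowSum a) ^ 2 * jb y ^ (-(10 / 3) : ℝ) := by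
  obtain ⟨Cη, hCη0, hCη⟩ := hη.exists_bound
  set c : ℝ := 200 * Cη * (s * 8 ^ (2 * s - 2)) with hc
  have hc0 : 0 < c := by positivity
  set d : ℝ := s * 8 ^ (2 * s - 2) * 2 ^ (4 * s) * 8 ^ (2 * s) with hd
  have hd0 : 0 < d := by positivity
  refine ⟨c + c * 8 ^ (2 * s - 2) + c * d, by positivity, fun x y a hxy hl => ?_⟩
  obtain ⟨h1, h2, h3, h4⟩ := high_comparable (freqNorm_nonneg x) (freqNorm_nonneg y) hθ₀ hθ hxy hl
  have hjx := jb_pos x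
  have hjy := jb_pos y
  have hB := abs_rpow_two_mul_sub_le (m := 8 * jb y) hs (freqNorm_nonneg x) (freqNorm_nonneg y)
    ((freqNorm_le_jb x).trans h1) ((freqNorm_le_jb y).trans (by linarith))
  obtain ⟨e1, -, e3⟩ := weight_estimates hη hCη hs hδ0 hδ (k := tupleDiff x y a) (a := a)
    (e := ![1, -1, 1, -1]) (by intro i; fin_cases i <;> simp) (x := x) (y := y) (ε := 1)
    (A := freqNorm x ^ 2 - freqNorm y ^ 2) (B := freqNorm x ^ (2 * s) - freqNorm y ^ (2 * s))
    (by simp)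
    (by rw [resonance, sum_signed_six]; simp [tupleDiff, Fin.sum_univ_four]; ring)
    (by rw [psi, sum_signed_six]; simp [tupleDiff, Fin.sum_univ_four]; ring)
    (by
      rw [lam, Real.sq_sqrt (Finset.sum_nonneg fun _ _ => sq_nonneg _)]
      simp [tupleDiff, Fin.sum_univ_succ]; ring)
    h1 h3 h4 hB
  rw [← hc] at e1 e3
  have hKP : 0 ≤ (1 + lowSum a) ^ 2 * jb y ^ (2 * s - 2) := by positivity
  have hKP' : 0 ≤ (1 + lowSum a) ^ 2 * jb x ^ (2 * s - 2) := by positivity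
  have hKP3 : 0 ≤ (1 + lowSum a) ^ 2 * jb y ^ (-(10 / 3) : ℝ) := by positivity
  have h8 : (0 : ℝ) ≤ c * 8 ^ (2 * s - 2) := by positivity
  have hcd : 0 ≤ c * d := by positivity
  refine ⟨?_, ?_, ?_⟩
  · calc _ ≤ c * (1 + lowSum a) ^ 2 * jb y ^ (2 * s - 2) := e1
      _ = c * ((1 + lowSum a) ^ 2 * jb y ^ (2 * s - 2)) := by ring
      _ ≤ (c + c * 8 ^ (2 * s - 2) + c * d) * ((1 + lowSum a) ^ 2 * jb y ^ (2 * s - 2)) := by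
          gcongr; linarith
      _ = _ := by ring
  · calc _ ≤ c * (1 + lowSum a) ^ 2 * jb y ^ (2 * s - 2) := e1
      _ ≤ c * (1 + lowSum a) ^ 2 * (8 ^ (2 * s - 2) * jb x ^ (2 * s - 2)) := by
          gcongr; exact jb_rpow_comparable hs h2
      _ = c * 8 ^ (2 * s - 2) * ((1 + lowSum a) ^ 2 * jb x ^ (2 * s - 2)) := by ring
      _ ≤ (c + c * 8 ^ (2 * s - 2) + c * d) * ((1 + lowSum a) ^ 2 * jb x ^ (2 * s - 2)) := by
          gcongr; linarith
      _ = _ := by ring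
  · calc _ ≤ |weight η s δ₀ (tupleDiff x y a) - diffSymbol s x y| *
          (d * jb y ^ (-(2 * s) - 2) * |freqNorm x ^ 2 - freqNorm y ^ 2|) := by
          gcongr; exact coeffVar_mul_coeffVar_le hs h1 h2
      _ = (|weight η s δ₀ (tupleDiff x y a) - diffSymbol s x y| *
          |freqNorm x ^ 2 - freqNorm y ^ 2|) * (d * jb y ^ (-(2 * s) - 2)) := by ring
      _ ≤ (c * (1 + lowSum a) ^ 2 * jb y ^ (2 * s - 2) * jb y ^ (2 / 3 : ℝ)) *
          (d * jb y ^ (-(2 * s) - 2)) := mul_le_mul_of_nonneg_right e3 (by positivity)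
      _ = c * d * (1 + lowSum a) ^ 2 *
          (jb y ^ (2 * s - 2) * jb y ^ (2 / 3 : ℝ) * jb y ^ (-(2 * s) - 2)) := by ring
      -- The exponents add up to `(2s - 2) + 2/3 - (2s + 2) = -10/3`, below the critical `-3` for
      -- summability on `ℤ³`.
      _ = c * d * ((1 + lowSum a) ^ 2 * jb y ^ (-(10 / 3) : ℝ)) := by
          rw [← Real.rpow_add hjy, ← Real.rpow_add hjy, mul_assoc]
          ring_nf
      _ ≤ (c + c * 8 ^ (2 * s - 2) + c * d) *
          ((1 + lowSum a) ^ 2 * jb y ^ (-(10 / 3) : ℝ)) := by gcongr; linarith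
      _ = _ := by ring

/-- With equal signs the leading denominator `S` dominates `|y|²`, so the gain `q / S` is worth
`⟨y⟩^(2/3 - 2)` without any difference of variances. The crude bound on `m` covers bounded `y`,
where `S` may vanish. -/
lemma addSymbol_estimates {s : ℝ} (hs : 1 ≤ s) {y : Freq} {m S c l : ℝ}
    (hS : freqNorm y ^ 2 ≤ S) (hm : |m| ≤ c * l * jb y ^ (2 * s - 2))
    (hmS : |m| * |S| ≤ c * l * jb y ^ (2 * s - 2) * jb y ^ (2 / 3 : ℝ)) (hc : 0 ≤ c * l) :
    |m| * coeffVar s y ≤ 4 * 2 ^ (2 * s) * (c * l) * jb y ^ (-(10 / 3) : ℝ) := by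
  have hjy := jb_pos y
  have hq : 1 ≤ jb y ^ (2 / 3 : ℝ) := Real.one_le_rpow (one_le_jb y) (by norm_num)
  have hS0 : 0 ≤ S := (sq_nonneg _).trans hS
  have hcv := coeffVar_pos s y
  rw [abs_of_nonneg hS0] at hmS
  have hP : 0 ≤ c * l * jb y ^ (2 * s - 2) := by positivity
  have h1 : |m| * jb y ^ 2 ≤ 4 * (c * l) * (jb y ^ (2 * s - 2) * jb y ^ (2 / 3 : ℝ)) := by
    calc |m| * jb y ^ 2 ≤ |m| * (2 * (1 + S)) := by
          have := jb_sq_le y; gcongr; linarith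
      _ = 2 * (|m| * 1 + |m| * S) := by ring
      _ ≤ 2 * (c * l * jb y ^ (2 * s - 2) * jb y ^ (2 / 3 : ℝ) +
          c * l * jb y ^ (2 * s - 2) * jb y ^ (2 / 3 : ℝ)) := by
          refine mul_le_mul_of_nonneg_left (add_le_add ?_ hmS) (by norm_num)
          rw [mul_one]
          exact hm.trans (le_mul_of_one_le_right hP hq)
      _ = _ := by ring
  have e2 : jb y ^ (-2 : ℝ) * jb y ^ 2 = 1 := by
    rw [← Real.rpow_natCast, ← Real.rpow_add hjy]; norm_num
  calc |m| * coeffVar s y ≤ |m| * (2 ^ (2 * s) * jb y ^ (-(2 * s))) := by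
        gcongr; exact coeffVar_le (by linarith) y
    _ = |m| * jb y ^ 2 * (2 ^ (2 * s) * jb y ^ (-(2 * s)) * jb y ^ (-2 : ℝ)) := by
        calc _ = |m| * (2 ^ (2 * s) * jb y ^ (-(2 * s))) * 1 := by ring
          _ = _ := by rw [← e2]; ring
    _ ≤ 4 * (c * l) * (jb y ^ (2 * s - 2) * jb y ^ (2 / 3 : ℝ)) *
        (2 ^ (2 * s) * jb y ^ (-(2 * s)) * jb y ^ (-2 : ℝ)) := by gcongr
    _ = 4 * 2 ^ (2 * s) * (c * l) * (jb y ^ (2 * s - 2) * jb y ^ (2 / 3 : ℝ) *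
        jb y ^ (-(2 * s)) * jb y ^ (-2 : ℝ)) := by ring
    _ = _ := by
        rw [← Real.rpow_add hjy, ← Real.rpow_add hjy, ← Real.rpow_add hjy]
        ring_nf

theorem weight_tupleAdd_estimates {η : ℝ → ℝ} (hη : IsBump η) {s θ δ₀ : ℝ} (hs : 1 ≤ s)
    (hθ₀ : 0 < θ) (hθ : θ < 1 / 3) (hδ0 : 0 ≤ δ₀) (hδ : δ₀ ≤ 2 / 3) :
    ∃ C : ℝ, 0 < C ∧ ∀ (x y : Freq) (a : Fin 4 → Freq) (k : Fin 6 → Freq),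
      k = tupleOdd x y a ∨ k = tupleEven x y a → |freqNorm x - freqNorm y| ≤ lowSum a →
      lowSum a ≤ freqNorm x ^ θ + freqNorm y ^ θ →
      |weight η s δ₀ k| ≤ C * (1 + lowSum a) ^ 2 * jb y ^ (2 * s - 2) ∧
      |weight η s δ₀ k - addSymbol s x y| * coeffVar s y ≤
        C * (1 + lowSum a) ^ 2 * jb y ^ (-(10 / 3) : ℝ) := by
  obtain ⟨Cη, hCη0, hCη⟩ := hη.exists_bound
  set c : ℝ := 200 * Cη * (s * 8 ^ (2 * s - 2)) with hc
  have hc0 : 0 < c := by positivity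
  refine ⟨c + 4 * 2 ^ (2 * s) * c, by positivity, fun x y a k hk hxy hl => ?_⟩
  obtain ⟨h1, -, h3, h4⟩ := high_comparable (freqNorm_nonneg x) (freqNorm_nonneg y) hθ₀ hθ hxy hl
  have hjy := jb_pos y
  have hfx := Real.rpow_nonneg (freqNorm_nonneg x) (2 * s)
  have hfy := Real.rpow_nonneg (freqNorm_nonneg y) (2 * s)
  have hB : |freqNorm x ^ (2 * s) + freqNorm y ^ (2 * s)| ≤
      s * (8 * jb y) ^ (2 * s - 2) * |freqNorm x ^ 2 + freqNorm y ^ 2| := by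
    rw [abs_of_nonneg (by positivity), abs_of_nonneg (by positivity), mul_assoc]
    refine (add_rpow_two_mul_add_le (m := 8 * jb y) hs (freqNorm_nonneg x) (freqNorm_nonneg y)
      ((freqNorm_le_jb x).trans h1) ((freqNorm_le_jb y).trans (by linarith))).trans ?_
    exact le_mul_of_one_le_left (by positivity) hs
  have hlam : lam k ^ 2 = freqNorm x ^ 2 + freqNorm y ^ 2 + ∑ i, freqNorm (a i) ^ 2 := by
    rw [lam, Real.sq_sqrt (Finset.sum_nonneg fun _ _ => sq_nonneg _)]
    rcases hk with rfl | rfl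
    · simp [tupleOdd, Fin.sum_univ_succ]; ring
    · simp [tupleEven, Fin.sum_univ_succ]; ring
  -- Up to the global sign `ε` both configurations have the same low-frequency sign pattern, thanks
  -- to the swapped last two entries in `tupleEven`. The sign drops out of the quotient, so both
  -- weights have the same leading symbol.
  obtain ⟨ε, hε, hΩ, hψ⟩ : ∃ ε : ℝ, |ε| = 1 ∧
      resonance k = ε * (freqNorm x ^ 2 + freqNorm y ^ 2 +
        ∑ i, (![-1, -1, 1, -1] : Fin 4 → ℝ) i * freqNorm (a i) ^ 2) ∧
      psi s k = ε * (freqNorm x ^ (2 * s) + freqNorm y ^ (2 * s) +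
        ∑ i, (![-1, -1, 1, -1] : Fin 4 → ℝ) i * freqNorm (a i) ^ (2 * s)) := by
    rcases hk with rfl | rfl
    · exact ⟨1, by simp,
        by rw [resonance, sum_signed_six]; simp [tupleOdd, Fin.sum_univ_four]; ring,
        by rw [psi, sum_signed_six]; simp [tupleOdd, Fin.sum_univ_four]; ring⟩
    · exact ⟨-1, by simp,
        by rw [resonance, sum_signed_six]; simp [tupleEven, Fin.sum_univ_four]; ring,
        by rw [psi, sum_signed_six]; simp [tupleEven, Fin.sum_univ_four]; ring⟩
  obtain ⟨e1, e2, e3⟩ := weight_estimates hη hCη hs hδ0 hδ (k := k) (a := a)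
    (by intro i; fin_cases i <;> simp) hε hΩ hψ hlam h1 h3 h4 hB
  rw [← hc] at e1 e2 e3
  have hKP : 0 ≤ (1 + lowSum a) ^ 2 * jb y ^ (2 * s - 2) := by positivity
  have hKP3 : 0 ≤ (1 + lowSum a) ^ 2 * jb y ^ (-(10 / 3) : ℝ) := by positivity
  have h2 : (0 : ℝ) ≤ 4 * 2 ^ (2 * s) * c := by positivity
  refine ⟨?_, ?_⟩
  · calc _ ≤ c * (1 + lowSum a) ^ 2 * jb y ^ (2 * s - 2) := e1
      _ = c * ((1 + lowSum a) ^ 2 * jb y ^ (2 * s - 2)) := by ring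
      _ ≤ (c + 4 * 2 ^ (2 * s) * c) * ((1 + lowSum a) ^ 2 * jb y ^ (2 * s - 2)) := by
          gcongr; linarith
      _ = _ := by ring
  · refine (addSymbol_estimates hs (le_add_of_nonneg_left (sq_nonneg _)) e2 e3
      (by positivity)).trans ?_
    calc _ = 4 * 2 ^ (2 * s) * c * ((1 + lowSum a) ^ 2 * jb y ^ (-(10 / 3) : ℝ)) := by ring
      _ ≤ (c + 4 * 2 ^ (2 * s) * c) * ((1 + lowSum a) ^ 2 * jb y ^ (-(10 / 3) : ℝ)) := by
          gcongr; linarith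
      _ = _ := by ring

/-! ### Cutoffs -/

/-- The frequencies with all coordinates at most `N` in absolute value. -/
def freqBox (N : ℕ) : Finset Freq := Fintype.piFinset fun _ => Finset.Icc (-(N : ℤ)) N

lemma cutoffAt_eq_zero {χ : EuclideanSpace ℝ (Fin 3) → ℝ} (hχ : IsRadialCutoff χ) {N : ℕ}
    (hN : 1 ≤ N) {k : Freq} (hk : k ∉ freqBox N) : cutoffAt χ N k = 0 := by
  by_contra h
  have h1 := hχ.support_subset (subset_tsupport χ h)
  rw [mem_ball_zero_iff, norm_smul, norm_inv, Real.norm_natCast] at h1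
  have hN0 : (0 : ℝ) < N := by exact_mod_cast hN
  rw [inv_mul_lt_iff₀ hN0, mul_one] at h1
  apply hk
  rw [freqBox, Fintype.mem_piFinset]
  intro i
  rw [Finset.mem_Icc, ← abs_le]
  have h2 := (abs_coord_le_freqNorm k i).trans h1.le
  exact_mod_cast h2

lemma IsRadialCutoff.exists_bound {χ : EuclideanSpace ℝ (Fin 3) → ℝ} (hχ : IsRadialCutoff χ) :
    ∃ C, 0 < C ∧ ∀ N k, |cutoffAt χ N k| ≤ C := by
  have hc : HasCompactSupport χ :=
    (isCompact_closedBall (0 : EuclideanSpace ℝ (Fin 3)) 1).of_isClosed_subset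
      (isClosed_tsupport χ) (hχ.support_subset.trans Metric.ball_subset_closedBall)
  obtain ⟨C, hC⟩ := hc.exists_bound_of_continuous hχ.smooth.continuous
  have hC0 : 0 ≤ C := (norm_nonneg _).trans (hC 0)
  refine ⟨C + 1, by linarith, fun N k => ?_⟩
  have := hC ((N : ℝ)⁻¹ • freqVec k)
  rw [Real.norm_eq_abs] at this
  rw [cutoffAt]
  linarith

lemma cutoffAt_congr {χ : EuclideanSpace ℝ (Fin 3) → ℝ} (hχ : IsRadialCutoff χ) (N : ℕ)
    {k l : Freq} (h : freqNorm k = freqNorm l) : cutoffAt χ N k = cutoffAt χ N l := by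
  refine hχ.radial _ _ ?_
  rw [norm_smul, norm_smul]
  congr 1

/-! ### Parametrization of the pairing sets -/

/-- Quadruples of frequencies. -/
abbrev Quad : Type := Fin 4 → Freq

/-- Quadruples with entries in `box`. -/
def quadBox (box : Finset Freq) : Finset Quad := Fintype.piFinset fun _ => box

/-- Pairs of quadruples with entries in `box` and the same image under `h`. -/
def pairIndex (box : Finset Freq) (h : Quad → Freq) : Finset (Quad × Quad) :=
  (quadBox box ×ˢ quadBox box).filter fun j => h j.1 = h j.2

/-- The constraint on the size of the low frequencies. -/
def Admissible (θ : ℝ) (x y : Freq) (a b : Quad) : Prop :=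
  lowSum a ≤ freqNorm x ^ θ + freqNorm y ^ θ ∧ lowSum b ≤ freqNorm x ^ θ + freqNorm y ^ θ

open Classical in
-- The paired frequency `n` and the two low quadruples are free parameters. The momentum constraints
-- reduce to `h a = h b`, which does not involve `n`, so the sum over `n` can be done inside.
lemma tsum_pairing {Λ : Set ((Fin 6 → Freq) × (Fin 5 → Freq))}
    {Φ : Freq × Quad × Quad → (Fin 6 → Freq) × (Fin 5 → Freq)} (hΦ : Function.Injective Φ)
    (hΛ : Λ ⊆ Set.range Φ) {P : Freq → Quad → Quad → Prop} {h : Quad → Freq}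
    (hmem : ∀ n a b, Φ (n, a, b) ∈ Λ ↔ h a = h b ∧ P n a b)
    {F : (Fin 6 → Freq) × (Fin 5 → Freq) → ℂ} {G : Freq → Quad → Quad → ℝ} {L : Quad × Quad → ℂ}
    {u : Freq → ℝ} {box : Finset Freq}
    (hF : ∀ n a b, F (Φ (n, a, b)) = ((G n a b * u n : ℝ) : ℂ) * L (a, b))
    (hu : ∀ n ∉ box, u n = 0) (hL : ∀ j ∉ quadBox box ×ˢ quadBox box, L j = 0) :
    ∑' x : Λ, F x.1 = ∑ j ∈ pairIndex box h,
      L j * ((∑ n ∈ box, (if P n j.1 j.2 then G n j.1 j.2 else 0) * u n : ℝ) : ℂ) := by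
  rw [tsum_subtype Λ F, ← hΦ.tsum_eq ((Set.support_indicator_subset).trans hΛ)]
  have hterm : ∀ t : Freq × Quad × Quad, Λ.indicator F (Φ t) =
      if h t.2.1 = h t.2.2 then L t.2 *
        (((if P t.1 t.2.1 t.2.2 then G t.1 t.2.1 t.2.2 else 0) * u t.1 : ℝ) : ℂ) else 0 := by
    rintro ⟨n, a, b⟩
    rw [Set.indicator_apply, hmem, hF]
    by_cases h1 : h a = h b <;> by_cases h2 : P n a b <;> simp [h1, h2, mul_comm]
  simp only [hterm]
  rw [tsum_eq_sum (s := box ×ˢ (quadBox box ×ˢ quadBox box)), Finset.sum_product_right]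
  · rw [pairIndex, Finset.sum_filter]
    refine Finset.sum_congr rfl fun j _ => ?_
    by_cases h1 : h j.1 = h j.2
    · simp only [h1, if_true]
      rw [Complex.ofReal_sum, Finset.mul_sum]
    · simp [h1]
  · rintro ⟨n, j⟩ hn
    rw [Finset.mem_product, not_and_or] at hn
    rcases hn with hn | hn
    · simp [hu n hn]
    · simp [hL j hn]

/-- `a₁ - a₂ + a₃ - a₄`. -/
def shiftDiff (a : Quad) : Freq := a 0 - a 1 + a 2 - a 3

/-- `a₁ + a₂ - a₃ + a₄`. -/
def shiftAdd (a : Quad) : Freq := a 0 + a 1 - a 2 + a 3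

lemma lowSum_eq (a : Quad) : lowSum a =
    freqNorm (a 0) + freqNorm (a 1) + freqNorm (a 2) + freqNorm (a 3) := by
  rw [lowSum, Fin.sum_univ_four]

lemma freqNorm_shiftDiff_le (a : Quad) : freqNorm (shiftDiff a) ≤ lowSum a := by
  rw [lowSum_eq, shiftDiff]
  linarith [freqNorm_sub_le (a 0 - a 1 + a 2) (a 3), freqNorm_add_le (a 0 - a 1) (a 2),
    freqNorm_sub_le (a 0) (a 1)]

lemma freqNorm_shiftAdd_le (a : Quad) : freqNorm (shiftAdd a) ≤ lowSum a := by
  rw [lowSum_eq, shiftAdd]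
  linarith [freqNorm_add_le (a 0 + a 1 - a 2) (a 3), freqNorm_sub_le (a 0 + a 1) (a 2),
    freqNorm_add_le (a 0) (a 1)]

lemma altSum_six (k : Fin 6 → Freq) : altSum k = k 0 - k 1 + k 2 - k 3 + k 4 - k 5 := by
  simp only [altSum, Fin.sum_univ_succ, Fin.sum_univ_zero]
  simp [Fin.succ, pow_succ]
  abel

lemma altSum_five (k : Fin 5 → Freq) : altSum k = k 0 - k 1 + k 2 - k 3 + k 4 := by
  simp only [altSum, Fin.sum_univ_succ, Fin.sum_univ_zero]
  simp [Fin.succ, pow_succ]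
  abel

lemma quad_eta (a : Quad) : ![a 0, a 1, a 2, a 3] = a := by
  ext i j; fin_cases i <;> rfl

/-- The low-frequency factor of `S11` and `S21`. -/
def lowDiff (j : Quad × Quad) (w : Freq → ℂ) : ℂ :=
  (w (j.1 0) * star (w (j.1 1)) * w (j.1 2) * star (w (j.1 3))) *
    (star (w (j.2 0)) * w (j.2 1) * star (w (j.2 2)) * w (j.2 3))

/-- The low-frequency factor of `S12`, and the conjugate of that of `S22`. -/
def lowAdd (j : Quad × Quad) (w : Freq → ℂ) : ℂ :=
  (star (w (j.1 0)) * star (w (j.1 1)) * w (j.1 2) * star (w (j.1 3))) *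
    (w (j.2 0) * w (j.2 1) * star (w (j.2 2)) * w (j.2 3))

lemma norm_lowDiff (j : Quad × Quad) (w : Freq → ℂ) :
    ‖lowDiff j w‖ = (∏ i, ‖w (j.1 i)‖) * ∏ i, ‖w (j.2 i)‖ := by
  simp [lowDiff, Fin.prod_univ_four]

lemma norm_lowAdd (j : Quad × Quad) (w : Freq → ℂ) :
    ‖lowAdd j w‖ = (∏ i, ‖w (j.1 i)‖) * ∏ i, ‖w (j.2 i)‖ := by
  simp [lowAdd, Fin.prod_univ_four]

lemma prod_norm_eq_zero {w : Freq → ℂ} {box : Finset Freq} (hw : ∀ n ∉ box, w n = 0)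
    {j : Quad × Quad} (hj : j ∉ quadBox box ×ˢ quadBox box) :
    (∏ i, ‖w (j.1 i)‖) * ∏ i, ‖w (j.2 i)‖ = 0 := by
  simp only [Finset.mem_product, quadBox, Fintype.mem_piFinset, not_and_or, not_forall] at hj
  rcases hj with ⟨i, hi⟩ | ⟨i, hi⟩
  · exact mul_eq_zero_of_left (Finset.prod_eq_zero (Finset.mem_univ i) (by simp [hw _ hi])) _
  · exact mul_eq_zero_of_right _ (Finset.prod_eq_zero (Finset.mem_univ i) (by simp [hw _ hi]))

section Expansions

variable (χ : EuclideanSpace ℝ (Fin 3) → ℝ) (η : ℝ → ℝ) (s θ δ₀ : ℝ) (N : ℕ)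

open Classical in
/-- The coefficients of `S11` as a quadratic form in the high frequencies. -/
def coeff11 (j : Quad × Quad) (n : Freq) : ℝ :=
  if Admissible θ (n - shiftDiff j.1) n j.1 j.2 then
    cutoffAt χ N (n - shiftDiff j.1) ^ 2 * weight η s δ₀ (tupleDiff (n - shiftDiff j.1) n j.1)
  else 0

open Classical in
/-- The coefficients of `S21` as a quadratic form in the high frequencies. -/
def coeff21 (j : Quad × Quad) (n : Freq) : ℝ :=
  if Admissible θ n (n + shiftDiff j.1) j.1 j.2 then
    cutoffAt χ N (n + shiftDiff j.1) ^ 2 * weight η s δ₀ (tupleDiff n (n + shiftDiff j.1) j.1)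
  else 0

open Classical in
/-- The coefficients of `S12` as a quadratic form in the high frequencies. -/
def coeff12 (j : Quad × Quad) (n : Freq) : ℝ :=
  if Admissible θ (shiftAdd j.1 - n) n j.1 j.2 then
    cutoffAt χ N (shiftAdd j.1 - n) ^ 2 * weight η s δ₀ (tupleOdd (shiftAdd j.1 - n) n j.1)
  else 0

open Classical in
/-- The coefficients of `S22` as a quadratic form in the high frequencies. -/
def coeff22 (j : Quad × Quad) (n : Freq) : ℝ :=
  if Admissible θ (shiftAdd j.1 - n) n j.1 j.2 then
    cutoffAt χ N (shiftAdd j.1 - n) ^ 2 * weight η s δ₀ (tupleEven (shiftAdd j.1 - n) n j.1)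
  else 0

/-- The two expressions `n - shiftDiff a` and `n - shiftDiff b` for the parent must agree, whence
the index set. -/
lemma S11_eq_sum {w : Freq → ℂ} {box : Finset Freq} (hw : ∀ n ∉ box, w n = 0) :
    S11 χ η s θ δ₀ N w = ∑ j ∈ pairIndex box shiftDiff,
    lowDiff j w * ((∑ n ∈ box, coeff11 χ η s θ δ₀ N j n * ‖w n‖ ^ 2 : ℝ) : ℂ) := by
  classical
  refine tsum_pairing
    (Φ := fun t => (tupleDiff (t.1 - shiftDiff t.2.1) t.1 t.2.1,
      ![t.1, t.2.2 0, t.2.2 1, t.2.2 2, t.2.2 3])) (h := shiftDiff)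
    (P := fun n a b => Admissible θ (n - shiftDiff a) n a b) (L := fun j => lowDiff j w)
    (F := fun x => ((cutoffAt χ N (x.1 0) ^ 2 * ‖w (x.1 1)‖ ^ 2 * weight η s δ₀ x.1 : ℝ) : ℂ) *
      (w (x.1 2) * star (w (x.1 3)) * w (x.1 4) * star (w (x.1 5))) *
      (star (w (x.2 1)) * w (x.2 2) * star (w (x.2 3)) * w (x.2 4)))
    (G := fun n a _ => cutoffAt χ N (n - shiftDiff a) ^ 2 *
      weight η s δ₀ (tupleDiff (n - shiftDiff a) n a)) (u := fun n => ‖w n‖ ^ 2) ?_ ?_ ?_ ?_ ?_ ?_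
  · rintro ⟨n, a, b⟩ ⟨n', a', b'⟩ h
    simp only [tupleDiff, Prod.mk.injEq, Matrix.vecCons_inj, and_true] at h
    obtain ⟨⟨-, h1, h2, h3, h4, h5⟩, -, h6, h7, h8, h9⟩ := h
    rw [h1, ← quad_eta a, ← quad_eta b, h2, h3, h4, h5, h6, h7, h8, h9, quad_eta, quad_eta]
  · rintro ⟨k, p⟩ ⟨h1, h2, h3, -, -⟩
    rw [altSum_six] at h1
    refine ⟨(k 1, ![k 2, k 3, k 4, k 5], ![p 1, p 2, p 3, p 4]), Prod.ext ?_ ?_⟩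
    · funext i
      fin_cases i <;> try rfl
      change k 1 - (k 2 - k 3 + k 4 - k 5) = k 0
      rw [← sub_eq_zero, ← neg_eq_zero, ← h1]; abel
    · funext i
      fin_cases i <;> first | rfl | exact h3
  · intro n a b
    simp only [Lambda11, Set.mem_ofPred_eq, altSum_six, altSum_five, Admissible, lowSum_eq]
    simp only [tupleDiff, shiftDiff, Matrix.cons_val]
    constructor
    · rintro ⟨-, h2, -, h4, h5⟩
      refine ⟨?_, h4, h5⟩
      rw [← sub_eq_zero, ← neg_eq_zero, ← sub_eq_zero.mpr h2]; abel
    · rintro ⟨h1, h4, h5⟩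
      refine ⟨by abel, ?_, trivial, h4, h5⟩
      rw [h1]; abel
  · intro n a b
    simp only [tupleDiff, lowDiff, Matrix.cons_val]
    push_cast; ring
  · intro n hn
    simp [hw n hn]
  · intro j hj
    rw [← norm_eq_zero, norm_lowDiff, prod_norm_eq_zero hw hj]

/-- The children are listed with neighbours swapped, so that the low-frequency factor and the index
set coincide with those of `S11`. -/
lemma S21_eq_sum {w : Freq → ℂ} {box : Finset Freq} (hw : ∀ n ∉ box, w n = 0) :
    S21 χ η s θ δ₀ N w = ∑ j ∈ pairIndex box shiftDiff,
    lowDiff j w * ((∑ n ∈ box, coeff21 χ η s θ δ₀ N j n * ‖w n‖ ^ 2 : ℝ) : ℂ) := by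
  classical
  refine tsum_pairing
    (Φ := fun t => (tupleDiff t.1 (t.1 + shiftDiff t.2.1) t.2.1,
      ![t.1, t.2.2 1, t.2.2 0, t.2.2 3, t.2.2 2])) (h := shiftDiff)
    (P := fun n a b => Admissible θ n (n + shiftDiff a) a b) (L := fun j => lowDiff j w)
    (F := fun x => ((cutoffAt χ N (x.1 1) ^ 2 * ‖w (x.1 0)‖ ^ 2 * weight η s δ₀ x.1 : ℝ) : ℂ) *
      (w (x.1 2) * star (w (x.1 3)) * w (x.1 4) * star (w (x.1 5))) *
      (star (w (x.2 2)) * w (x.2 1) * star (w (x.2 4)) * w (x.2 3)))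
    (G := fun n a _ => cutoffAt χ N (n + shiftDiff a) ^ 2 *
      weight η s δ₀ (tupleDiff n (n + shiftDiff a) a)) (u := fun n => ‖w n‖ ^ 2) ?_ ?_ ?_ ?_ ?_ ?_
  · rintro ⟨n, a, b⟩ ⟨n', a', b'⟩ h
    simp only [tupleDiff, Prod.mk.injEq, Matrix.vecCons_inj, and_true] at h
    obtain ⟨⟨h1, -, h2, h3, h4, h5⟩, -, h6, h7, h8, h9⟩ := h
    rw [h1, ← quad_eta a, ← quad_eta b, h2, h3, h4, h5, h6, h7, h8, h9, quad_eta, quad_eta]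
  · rintro ⟨k, q⟩ ⟨h1, h2, h3, -, -⟩
    rw [altSum_six] at h1
    refine ⟨(k 0, ![k 2, k 3, k 4, k 5], ![q 2, q 1, q 4, q 3]), Prod.ext ?_ ?_⟩
    · funext i
      fin_cases i <;> try rfl
      change k 0 + (k 2 - k 3 + k 4 - k 5) = k 1
      rw [← sub_eq_zero, ← h1]; abel
    · funext i
      fin_cases i <;> first | rfl | exact h3
  · intro n a b
    simp only [Lambda21, Set.mem_ofPred_eq, altSum_six, altSum_five, Admissible, lowSum_eq]
    simp only [tupleDiff, shiftDiff, Matrix.cons_val]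
    have e : freqNorm (b 1) + freqNorm (b 0) + freqNorm (b 3) + freqNorm (b 2) =
      freqNorm (b 0) + freqNorm (b 1) + freqNorm (b 2) + freqNorm (b 3) := by ring
    rw [e]
    constructor
    · rintro ⟨-, h2, -, h4, h5⟩
      refine ⟨?_, h4, h5⟩
      rw [← sub_eq_zero, ← sub_eq_zero.mpr h2]; abel
    · rintro ⟨h1, h4, h5⟩
      refine ⟨by abel, ?_, trivial, h4, h5⟩
      rw [h1]; abel
  · intro n a b
    simp only [tupleDiff, lowDiff, Matrix.cons_val]
    push_cast; ring
  · intro n hn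
    simp [hw n hn]
  · intro j hj
    rw [← norm_eq_zero, norm_lowDiff, prod_norm_eq_zero hw hj]

lemma S12_eq_sum {w : Freq → ℂ} {box : Finset Freq} (hw : ∀ n ∉ box, w n = 0) :
    S12 χ η s θ δ₀ N w = ∑ j ∈ pairIndex box shiftAdd,
    lowAdd j w * ((∑ n ∈ box, coeff12 χ η s θ δ₀ N j n * ‖w n‖ ^ 2 : ℝ) : ℂ) := by
  classical
  refine tsum_pairing
    (Φ := fun t => (tupleOdd (shiftAdd t.2.1 - t.1) t.1 t.2.1,
      ![t.2.2 0, t.1, t.2.2 1, t.2.2 2, t.2.2 3])) (h := shiftAdd)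
    (P := fun n a b => Admissible θ (shiftAdd a - n) n a b) (L := fun j => lowAdd j w)
    (F := fun x => ((cutoffAt χ N (x.1 0) ^ 2 * ‖w (x.1 2)‖ ^ 2 * weight η s δ₀ x.1 : ℝ) : ℂ) *
      (star (w (x.1 1)) * star (w (x.1 3)) * w (x.1 4) * star (w (x.1 5))) *
      (w (x.2 0) * w (x.2 2) * star (w (x.2 3)) * w (x.2 4)))
    (G := fun n a _ => cutoffAt χ N (shiftAdd a - n) ^ 2 *
      weight η s δ₀ (tupleOdd (shiftAdd a - n) n a)) (u := fun n => ‖w n‖ ^ 2) ?_ ?_ ?_ ?_ ?_ ?_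
  · rintro ⟨n, a, b⟩ ⟨n', a', b'⟩ h
    simp only [tupleOdd, Prod.mk.injEq, Matrix.vecCons_inj, and_true] at h
    obtain ⟨⟨-, h2, h1, h3, h4, h5⟩, h6, -, h7, h8, h9⟩ := h
    rw [h1, ← quad_eta a, ← quad_eta b, h2, h3, h4, h5, h6, h7, h8, h9, quad_eta, quad_eta]
  · rintro ⟨k, p⟩ ⟨h1, h2, h3, -, -⟩
    rw [altSum_six] at h1
    refine ⟨(k 2, ![k 1, k 3, k 4, k 5], ![p 0, p 2, p 3, p 4]), Prod.ext ?_ ?_⟩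
    · funext i
      fin_cases i <;> try rfl
      change k 1 + k 3 - k 4 + k 5 - k 2 = k 0
      rw [← sub_eq_zero, ← neg_eq_zero, ← h1]; abel
    · funext i
      fin_cases i <;> first | rfl | exact h3
  · intro n a b
    simp only [Lambda12, Set.mem_ofPred_eq, altSum_six, altSum_five, Admissible, lowSum_eq]
    simp only [tupleOdd, shiftAdd, Matrix.cons_val]
    constructor
    · rintro ⟨-, h2, -, h4, h5⟩
      refine ⟨?_, h4, h5⟩
      rw [← sub_eq_zero, ← sub_eq_zero.mpr h2]; abel
    · rintro ⟨h1, h4, h5⟩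
      refine ⟨by abel, ?_, trivial, h4, h5⟩
      rw [h1]; abel
  · intro n a b
    simp only [tupleOdd, lowAdd, Matrix.cons_val]
    push_cast; ring
  · intro n hn
    simp [hw n hn]
  · intro j hj
    rw [← norm_eq_zero, norm_lowAdd, prod_norm_eq_zero hw hj]

/-- The last two first-generation frequencies are exchanged in order to obtain exactly the conjugate
of the factor in `S12`. -/
lemma S22_eq_sum {w : Freq → ℂ} {box : Finset Freq} (hw : ∀ n ∉ box, w n = 0) :
    S22 χ η s θ δ₀ N w = ∑ j ∈ pairIndex box shiftAdd,
    star (lowAdd j w) * ((∑ n ∈ box, coeff22 χ η s θ δ₀ N j n * ‖w n‖ ^ 2 : ℝ) : ℂ) := by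
  classical
  refine tsum_pairing
    (Φ := fun t => (tupleEven (shiftAdd t.2.1 - t.1) t.1 t.2.1,
      ![t.2.2 0, t.1, t.2.2 1, t.2.2 2, t.2.2 3])) (h := shiftAdd)
    (P := fun n a b => Admissible θ (shiftAdd a - n) n a b) (L := fun j => star (lowAdd j w))
    (F := fun x => ((cutoffAt χ N (x.1 1) ^ 2 * ‖w (x.1 3)‖ ^ 2 * weight η s δ₀ x.1 : ℝ) : ℂ) *
      (w (x.1 0) * w (x.1 2) * w (x.1 4) * star (w (x.1 5))) *
      (star (w (x.2 0)) * star (w (x.2 2)) * star (w (x.2 4)) * w (x.2 3)))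
    (G := fun n a _ => cutoffAt χ N (shiftAdd a - n) ^ 2 *
      weight η s δ₀ (tupleEven (shiftAdd a - n) n a)) (u := fun n => ‖w n‖ ^ 2) ?_ ?_ ?_ ?_ ?_ ?_
  · rintro ⟨n, a, b⟩ ⟨n', a', b'⟩ h
    simp only [tupleEven, Prod.mk.injEq, Matrix.vecCons_inj, and_true] at h
    obtain ⟨⟨h2, -, h3, h1, h5, h4⟩, h6, -, h7, h8, h9⟩ := h
    rw [h1, ← quad_eta a, ← quad_eta b, h2, h3, h4, h5, h6, h7, h8, h9, quad_eta, quad_eta]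
  · rintro ⟨k, q⟩ ⟨h1, h2, h3, -, -⟩
    rw [altSum_six] at h1
    refine ⟨(k 3, ![k 0, k 2, k 5, k 4], ![q 0, q 2, q 3, q 4]), Prod.ext ?_ ?_⟩
    · funext i
      fin_cases i <;> try rfl
      change k 0 + k 2 - k 5 + k 4 - k 3 = k 1
      rw [← sub_eq_zero, ← h1]; abel
    · funext i
      fin_cases i <;> first | rfl | exact h3
  · intro n a b
    simp only [Lambda22, Set.mem_ofPred_eq, altSum_six, altSum_five, Admissible, lowSum_eq]
    simp only [tupleEven, shiftAdd, Matrix.cons_val]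
    have e : freqNorm (a 0) + freqNorm (a 1) + freqNorm (a 3) + freqNorm (a 2) =
      freqNorm (a 0) + freqNorm (a 1) + freqNorm (a 2) + freqNorm (a 3) := by ring
    rw [e]
    constructor
    · rintro ⟨-, h2, -, h4, h5⟩
      refine ⟨?_, h4, h5⟩
      rw [← sub_eq_zero, ← sub_eq_zero.mpr h2]; abel
    · rintro ⟨h1, h4, h5⟩
      refine ⟨by abel, ?_, trivial, h4, h5⟩
      rw [h1]; abel
  · intro n a b
    simp only [tupleEven, lowAdd, Matrix.cons_val, star_mul', star_star]
    push_cast; ring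
  · intro n hn
    simp [hw n hn]
  · intro j hj
    rw [← norm_eq_zero, norm_star, norm_lowAdd, prod_norm_eq_zero hw hj]

end Expansions

/-! ### Sums over the low frequencies -/

/-- Turns the polynomial loss into a product, so that the low-frequency sums factorize. -/
lemma one_add_lowSum_le (a : Quad) : 1 + lowSum a ≤ ∏ i, jb (a i) := by
  have step : ∀ x y : ℝ, 0 ≤ x → 0 ≤ y → 1 + (x + y) ≤ (1 + x) * (1 + y) := fun x y hx hy => by
    nlinarith [mul_nonneg hx hy]
  have h := fun i => freqNorm_nonneg (a i)
  rw [lowSum_eq, Fin.prod_univ_four]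
  unfold jb
  have h01 := add_nonneg (h 0) (h 1)
  have h2 := h 2
  have h3 := h 3
  calc _ ≤ (1 + (freqNorm (a 0) + freqNorm (a 1) + freqNorm (a 2))) * (1 + freqNorm (a 3)) :=
        step _ _ (by positivity) (h 3)
    _ ≤ (1 + (freqNorm (a 0) + freqNorm (a 1))) * (1 + freqNorm (a 2)) * (1 + freqNorm (a 3)) := by
        gcongr; exact step _ _ h01 h2
    _ ≤ _ := by gcongr; exact step _ _ (h 0) (h 1)

/-- The size of the low-frequency factors on the unit Sobolev ball. -/
def lowSize (σ : ℝ) (j : Quad × Quad) : ℝ :=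
  (2 ^ σ) ^ 8 * ((∏ i, jb (j.1 i) ^ (-σ)) * ∏ i, jb (j.2 i) ^ (-σ))

lemma lowSize_nonneg (σ : ℝ) (j : Quad × Quad) : 0 ≤ lowSize σ j := by
  have h : ∀ a : Quad, 0 ≤ ∏ i, jb (a i) ^ (-σ) := fun a =>
    Finset.prod_nonneg fun i _ => Real.rpow_nonneg (jb_pos _).le _
  have h1 := h j.1
  have h2 := h j.2
  unfold lowSize
  positivity

lemma prod_norm_le_lowSize {σ R : ℝ} (hσ : 0 ≤ σ) (hR : 0 ≤ R) {w : Freq → ℂ}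
    (hw : w ∈ sobolevBall σ R) (j : Quad × Quad) :
    (∏ i, ‖w (j.1 i)‖) * ∏ i, ‖w (j.2 i)‖ ≤ R ^ 8 * lowSize σ j := by
  have h : ∀ a : Quad, ∏ i, ‖w (a i)‖ ≤ (2 ^ σ * R) ^ 4 * ∏ i, jb (a i) ^ (-σ) := by
    intro a
    calc _ ≤ ∏ i, 2 ^ σ * R * jb (a i) ^ (-σ) :=
          Finset.prod_le_prod (fun _ _ => norm_nonneg _)
            fun i _ => norm_le_of_mem_sobolevBall hσ hR hw (a i)
      _ = _ := by rw [Finset.prod_mul_distrib]; simp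
  calc _ ≤ ((2 ^ σ * R) ^ 4 * ∏ i, jb (j.1 i) ^ (-σ)) * ((2 ^ σ * R) ^ 4 * ∏ i, jb (j.2 i) ^ (-σ)) :=
        mul_le_mul (h _) (h _) (Finset.prod_nonneg fun _ _ => norm_nonneg _)
          ((Finset.prod_nonneg fun _ _ => norm_nonneg _).trans (h j.1))
    _ = _ := by rw [lowSize]; ring

/-- Once the constraint `h a = h b` is dropped, the sum splits into eight independent sums over `ℤ³`
with exponents `σ - 2` and `σ`, both above `3`. -/
lemma sum_lowSize_le {σ : ℝ} (hσ : 8 ≤ σ) : ∃ Q : ℝ, 0 < Q ∧ ∀ (box : Finset Freq)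
    (h : Quad → Freq), ∑ j ∈ pairIndex box h, lowSize σ j * (1 + lowSum j.1) ^ 2 ≤ Q := by
  set A : ℝ := ∑' k : Freq, jb k ^ (-(σ - 2)) with hA
  set B : ℝ := ∑' k : Freq, jb k ^ (-σ) with hB
  have hnn : ∀ (r : ℝ) (k : Freq), 0 ≤ jb k ^ r := fun r k => Real.rpow_nonneg (jb_pos k).le r
  have hA0 : 0 ≤ A := tsum_nonneg fun k => hnn _ k
  have hB0 : 0 ≤ B := tsum_nonneg fun k => hnn _ k
  have hpi : ∀ (box : Finset Freq) (r C : ℝ), 3 < r → C = ∑' k : Freq, jb k ^ (-r) →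
      ∑ a ∈ quadBox box, ∏ i, jb (a i) ^ (-r) ≤ C ^ 4 := by
    intro box r C hr hC
    have e := Finset.prod_univ_sum (fun _ : Fin 4 => box) (fun _ k => jb k ^ (-r))
    rw [quadBox, ← e, Finset.prod_const, Finset.card_univ, Fintype.card_fin, hC]
    exact pow_le_pow_left₀ (Finset.sum_nonneg fun k _ => hnn _ k)
      ((summable_jb hr).sum_le_tsum box fun k _ => hnn _ k) 4
  refine ⟨(2 ^ σ) ^ 8 * (A ^ 4 * B ^ 4) + 1, by positivity, fun box h => ?_⟩
  have hterm : ∀ j : Quad × Quad, lowSize σ j * (1 + lowSum j.1) ^ 2 ≤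
      (2 ^ σ) ^ 8 * ((∏ i, jb (j.1 i) ^ (-(σ - 2))) * ∏ i, jb (j.2 i) ^ (-σ)) := by
    intro j
    have h0 := lowSum_nonneg j.1
    calc _ ≤ lowSize σ j * (∏ i, jb (j.1 i)) ^ 2 :=
          mul_le_mul_of_nonneg_left
            (pow_le_pow_left₀ (by linarith) (one_add_lowSum_le j.1) 2) (lowSize_nonneg σ j)
      _ = (2 ^ σ) ^ 8 * ((∏ i, jb (j.1 i) ^ (-σ) * jb (j.1 i) ^ 2) * ∏ i, jb (j.2 i) ^ (-σ)) := by
          rw [lowSize, Finset.prod_mul_distrib, Finset.prod_pow]; ring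
      _ = _ := by
          congr 3
          funext i
          rw [← Real.rpow_natCast, ← Real.rpow_add (jb_pos _)]
          congr 1; push_cast; ring
  calc _ ≤ ∑ j ∈ pairIndex box h,
        (2 ^ σ) ^ 8 * ((∏ i, jb (j.1 i) ^ (-(σ - 2))) * ∏ i, jb (j.2 i) ^ (-σ)) :=
        Finset.sum_le_sum fun j _ => hterm j
    _ ≤ ∑ j ∈ quadBox box ×ˢ quadBox box,
        (2 ^ σ) ^ 8 * ((∏ i, jb (j.1 i) ^ (-(σ - 2))) * ∏ i, jb (j.2 i) ^ (-σ)) :=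
        Finset.sum_le_sum_of_subset_of_nonneg (Finset.filter_subset _ _) fun j _ _ =>
          mul_nonneg (by positivity) (mul_nonneg (Finset.prod_nonneg fun i _ => hnn _ _)
            (Finset.prod_nonneg fun i _ => hnn _ _))
    _ = (2 ^ σ) ^ 8 * ((∑ a ∈ quadBox box, ∏ i, jb (a i) ^ (-(σ - 2))) *
        ∑ b ∈ quadBox box, ∏ i, jb (b i) ^ (-σ)) := by
        rw [← Finset.mul_sum, Finset.sum_product, Finset.sum_mul_sum]
    _ ≤ (2 ^ σ) ^ 8 * (A ^ 4 * B ^ 4) := by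
        have h1 := hpi box (σ - 2) A (by linarith) hA
        have h2 := hpi box σ B (by linarith) hB
        have h3 : 0 ≤ ∑ b ∈ quadBox box, ∏ i, jb (b i) ^ (-σ) :=
          Finset.sum_nonneg fun _ _ => Finset.prod_nonneg fun i _ => hnn _ _
        gcongr
    _ ≤ _ := by linarith

lemma measurable_lowDiff (j : Quad × Quad) : Measurable fun w => (lowDiff j w).im := by
  refine Complex.measurable_im.comp ?_
  unfold lowDiff
  fun_prop

lemma measurable_lowAdd (j : Quad × Quad) : Measurable fun w => (lowAdd j w).im := by
  refine Complex.measurable_im.comp ?_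
  unfold lowAdd
  fun_prop

/-! ### Bounds on the coefficients and cancellation in the means -/

lemma abs_freqNorm_sub_freqNorm_le (x y : Freq) :
    |freqNorm x - freqNorm y| ≤ freqNorm (x - y) := by
  have h1 := freqNorm_add_le (x - y) y
  have h2 := freqNorm_sub_le x (x - y)
  rw [sub_add_cancel] at h1
  rw [sub_sub_cancel] at h2
  exact abs_le.mpr ⟨by linarith, by linarith⟩

lemma freqNorm_sub_comm (x y : Freq) : freqNorm (x - y) = freqNorm (y - x) := by
  rw [← neg_sub, freqNorm_neg]

lemma abs_freqNorm_shiftDiff (a : Quad) (n : Freq) :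
    |freqNorm (n - shiftDiff a) - freqNorm n| ≤ lowSum a := by
  refine (abs_freqNorm_sub_freqNorm_le _ _).trans ((le_of_eq ?_).trans (freqNorm_shiftDiff_le a))
  rw [← freqNorm_neg]; congr 1; abel

lemma abs_freqNorm_shiftDiff' (a : Quad) (n : Freq) :
    |freqNorm n - freqNorm (n + shiftDiff a)| ≤ lowSum a := by
  have := abs_freqNorm_shiftDiff a (n + shiftDiff a)
  rwa [add_sub_cancel_right] at this

lemma abs_freqNorm_shiftAdd (a : Quad) (n : Freq) :
    |freqNorm (shiftAdd a - n) - freqNorm n| ≤ lowSum a := by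
  rw [← freqNorm_neg n]
  refine (abs_freqNorm_sub_freqNorm_le _ _).trans ((le_of_eq ?_).trans (freqNorm_shiftAdd_le a))
  congr 1; abel

lemma sum_jb_le (box : Finset Freq) :
    ∑ n ∈ box, jb n ^ (-(10 / 3) : ℝ) ≤ ∑' n : Freq, jb n ^ (-(10 / 3) : ℝ) :=
  (summable_jb (by norm_num)).sum_le_tsum box fun k _ => Real.rpow_nonneg (jb_pos k).le _

lemma coeffVar_congr (s : ℝ) {k l : Freq} (h : freqNorm k = freqNorm l) :
    coeffVar s k = coeffVar s l := by
  rw [coeffVar, coeffVar, h]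

lemma sq_le_of_abs_le {x C : ℝ} (h : |x| ≤ C) : x ^ 2 ≤ C ^ 2 := by
  rw [← sq_abs]; exact pow_le_pow_left₀ (abs_nonneg _) h 2

open Classical in
/-- The part of the mean of `S11 - S21` with symbol `diffSymbol` vanishes under `n ↦ h - n`. -/
lemma tsum_diffSymbol_eq_zero {χ : EuclideanSpace ℝ (Fin 3) → ℝ} (hχ : IsRadialCutoff χ)
    (s θ : ℝ) (N : ℕ) (a b : Quad) (h : Freq) :
    ∑' n, (if Admissible θ (n - h) n a b then
      cutoffAt χ N n ^ 2 * cutoffAt χ N (n - h) ^ 2 * diffSymbol s (n - h) n else 0) *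
        (coeffVar s n - coeffVar s (n - h)) = 0 := by
  set f : Freq → ℝ := fun n => (if Admissible θ (n - h) n a b then
      cutoffAt χ N n ^ 2 * cutoffAt χ N (n - h) ^ 2 * diffSymbol s (n - h) n else 0) *
        (coeffVar s n - coeffVar s (n - h)) with hf
  -- The reflection exchanges `|n|` and `|n - h|`. Radial cutoffs, symbol and size constraint are
  -- symmetric under this exchange; the difference of variances changes sign.
  have hodd : ∀ n, f (h - n) = -f n := by
    intro n
    have e1 : freqNorm (h - n) = freqNorm (n - h) := freqNorm_sub_comm _ _
    have e2 : freqNorm (h - n - h) = freqNorm n := by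
      rw [← freqNorm_neg n]; congr 1; abel
    have e3 : Admissible θ (h - n - h) (h - n) a b ↔ Admissible θ (n - h) n a b := by
      rw [Admissible, Admissible, e1, e2, add_comm]
    have e4 : diffSymbol s (h - n - h) (h - n) = diffSymbol s (n - h) n := by
      rw [diffSymbol_comm s (n - h) n, diffSymbol, diffSymbol, e1, e2]
    simp only [hf]
    rw [cutoffAt_congr hχ N e1, cutoffAt_congr hχ N e2, coeffVar_congr s e1, coeffVar_congr s e2,
      e4]
    simp only [e3]
    split_ifs <;> ring
  have h1 : ∑' n, f (h - n) = ∑' n, f n := (Equiv.subLeft h).tsum_eq f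
  simp only [hodd, tsum_neg] at h1
  linarith

/-- The mean of each sum alone is only `∑ ⟨n⟩^(-2)`. Translating the second by `shiftDiff a` gives
both the same coefficients, with variances at the two different high frequencies; subtracting the
odd leading part then leaves a summable error. -/
lemma abs_diff_coeff_le {χ : EuclideanSpace ℝ (Fin 3) → ℝ} {Cχ : ℝ}
    (hCχ : ∀ N k, |cutoffAt χ N k| ≤ Cχ) {η : ℝ → ℝ} (hη : IsBump η) {s θ δ₀ : ℝ} (hs : 1 ≤ s)
    (hθ₀ : 0 < θ) (hθ : θ < 1 / 3) (hδ0 : 0 ≤ δ₀) (hδ : δ₀ ≤ 2 / 3) (hχ : IsRadialCutoff χ) :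
    ∃ C : ℝ, 0 < C ∧ ∀ (N : ℕ) (j : Quad × Quad), 1 ≤ N →
      (∀ n, |coeff11 χ η s θ δ₀ N j n - coeff21 χ η s θ δ₀ N j n| ≤
        C * (1 + lowSum j.1) ^ 2 * jb n ^ (2 * s - 2)) ∧
      |∑ n ∈ freqBox N, (coeff11 χ η s θ δ₀ N j n - coeff21 χ η s θ δ₀ N j n) *
        (cutoffAt χ N n ^ 2 * coeffVar s n)| ≤ C * (1 + lowSum j.1) ^ 2 := by
  classical
  obtain ⟨C, hC, hest⟩ := weight_tupleDiff_estimates hη hs hθ₀ hθ hδ0 hδ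
  set S : ℝ := ∑' n : Freq, jb n ^ (-(10 / 3) : ℝ) with hS
  have hS0 : 0 ≤ S := tsum_nonneg fun k => Real.rpow_nonneg (jb_pos k).le _
  refine ⟨2 * Cχ ^ 2 * C + Cχ ^ 4 * C * S + 1, by positivity, ?_⟩
  rintro N ⟨a, b⟩ hN
  have hK : 0 ≤ (1 + lowSum a) ^ 2 := sq_nonneg _
  set h := shiftDiff a with hh
  constructor
  · intro n
    have hP := Real.rpow_nonneg (jb_pos n).le (2 * s - 2)
    have hbase : 0 ≤ Cχ ^ 2 * (C * (1 + lowSum a) ^ 2 * jb n ^ (2 * s - 2)) := by positivity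
    have h1 : |coeff11 χ η s θ δ₀ N (a, b) n| ≤
        Cχ ^ 2 * (C * (1 + lowSum a) ^ 2 * jb n ^ (2 * s - 2)) := by
      rw [coeff11]
      split_ifs with hadm
      · rw [abs_mul, abs_of_nonneg (sq_nonneg _)]
        exact mul_le_mul (sq_le_of_abs_le (hCχ _ _))
          (hest _ _ _ (abs_freqNorm_shiftDiff a n) hadm.1).1 (abs_nonneg _) (sq_nonneg _)
      · rwa [abs_zero]
    have h2 : |coeff21 χ η s θ δ₀ N (a, b) n| ≤
        Cχ ^ 2 * (C * (1 + lowSum a) ^ 2 * jb n ^ (2 * s - 2)) := by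
      rw [coeff21]
      split_ifs with hadm
      · rw [abs_mul, abs_of_nonneg (sq_nonneg _)]
        exact mul_le_mul (sq_le_of_abs_le (hCχ _ _))
          (hest _ _ _ (abs_freqNorm_shiftDiff' a n) hadm.1).2.1 (abs_nonneg _) (sq_nonneg _)
      · rwa [abs_zero]
    calc _ ≤ _ := abs_sub _ _
      _ ≤ _ := add_le_add h1 h2
      _ = 2 * Cχ ^ 2 * C * ((1 + lowSum a) ^ 2 * jb n ^ (2 * s - 2)) := by ring
      _ ≤ (2 * Cχ ^ 2 * C + Cχ ^ 4 * C * S + 1) * ((1 + lowSum a) ^ 2 * jb n ^ (2 * s - 2)) := by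
          gcongr
          have : 0 ≤ Cχ ^ 4 * C * S := by positivity
          linarith
      _ = _ := by ring
  · have hz : ∀ n ∉ freqBox N, cutoffAt χ N n = 0 := fun n hn => cutoffAt_eq_zero hχ hN hn
    let T : Freq → ℝ := fun n => if Admissible θ (n - h) n a b then
      cutoffAt χ N n ^ 2 * cutoffAt χ N (n - h) ^ 2 * weight η s δ₀ (tupleDiff (n - h) n a) else 0
    let T₀ : Freq → ℝ := fun n => if Admissible θ (n - h) n a b then
      cutoffAt χ N n ^ 2 * cutoffAt χ N (n - h) ^ 2 * diffSymbol s (n - h) n else 0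
    have hT : ∀ n ∉ freqBox N, T n = 0 := fun n hn => by simp [T, hz n hn]
    have hT₀ : ∀ n ∉ freqBox N, T₀ n = 0 := fun n hn => by simp [T₀, hz n hn]
    have hts : ∀ f : Freq → ℝ, (∀ n ∉ freqBox N, f n = 0) →
        ∑ n ∈ freqBox N, f n = ∑' n, f n := fun f hf => (tsum_eq_sum hf).symm
    have s1 : ∑ n ∈ freqBox N, coeff11 χ η s θ δ₀ N (a, b) n *
        (cutoffAt χ N n ^ 2 * coeffVar s n) = ∑ n ∈ freqBox N, T n * coeffVar s n := by
      refine Finset.sum_congr rfl fun n _ => ?_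
      simp only [T, coeff11, ← hh]
      split_ifs <;> ring
    -- Both summands carry the cutoff at `n` and vanish off the box, so the translation can be made
    -- over the whole lattice.
    have s2 : ∑ n ∈ freqBox N, coeff21 χ η s θ δ₀ N (a, b) n *
        (cutoffAt χ N n ^ 2 * coeffVar s n) = ∑ n ∈ freqBox N, T n * coeffVar s (n - h) := by
      rw [hts _ (fun n hn => by simp [hz n hn]), hts _ (fun n hn => by simp [hT n hn]),
        ← (Equiv.addRight h).tsum_eq (fun n => T n * coeffVar s (n - h))]
      refine tsum_congr fun n => ?_
      simp only [T, coeff21, ← hh, Equiv.coe_addRight, add_sub_cancel_right]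
      split_ifs <;> ring
    have s3 : ∑ n ∈ freqBox N, T₀ n * (coeffVar s n - coeffVar s (n - h)) = 0 := by
      rw [hts _ (fun n hn => by simp [hT₀ n hn])]
      exact tsum_diffSymbol_eq_zero hχ s θ N a b h
    have s4 : ∑ n ∈ freqBox N, (coeff11 χ η s θ δ₀ N (a, b) n - coeff21 χ η s θ δ₀ N (a, b) n) *
        (cutoffAt χ N n ^ 2 * coeffVar s n) =
        ∑ n ∈ freqBox N, (T n - T₀ n) * (coeffVar s n - coeffVar s (n - h)) := by
      simp only [sub_mul, mul_sub, Finset.sum_sub_distrib] at s3 ⊢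
      rw [s1, s2]
      linarith
    rw [s4]
    calc _ ≤ ∑ n ∈ freqBox N, |(T n - T₀ n) * (coeffVar s n - coeffVar s (n - h))| :=
          Finset.abs_sum_le_sum_abs _ _
      _ ≤ ∑ n ∈ freqBox N, Cχ ^ 4 * (C * (1 + lowSum a) ^ 2) * jb n ^ (-(10 / 3) : ℝ) := by
          refine Finset.sum_le_sum fun n _ => ?_
          have hP := Real.rpow_nonneg (jb_pos n).le (-(10 / 3))
          by_cases hadm : Admissible θ (n - h) n a b
          · have e : T n - T₀ n = cutoffAt χ N n ^ 2 * cutoffAt χ N (n - h) ^ 2 *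
                (weight η s δ₀ (tupleDiff (n - h) n a) - diffSymbol s (n - h) n) := by
              simp only [T, T₀, hadm, if_true]; ring
            rw [e, abs_mul, abs_mul, abs_of_nonneg (by positivity), mul_assoc, mul_assoc (Cχ ^ 4)]
            have := (hest _ _ _ (abs_freqNorm_shiftDiff a n) hadm.1).2.2
            refine mul_le_mul ?_ this (by positivity) (by positivity)
            calc _ ≤ Cχ ^ 2 * Cχ ^ 2 :=
                  mul_le_mul (sq_le_of_abs_le (hCχ _ _)) (sq_le_of_abs_le (hCχ _ _))
                    (sq_nonneg _) (sq_nonneg _)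
              _ = _ := by ring
          · have e : T n - T₀ n = 0 := by simp [T, T₀, hadm]
            rw [e, zero_mul, abs_zero]
            positivity
      _ ≤ Cχ ^ 4 * (C * (1 + lowSum a) ^ 2) * S := by
          rw [← Finset.mul_sum]
          gcongr
          exact sum_jb_le _
      _ = Cχ ^ 4 * C * S * (1 + lowSum a) ^ 2 := by ring
      _ ≤ _ := by
          gcongr
          have : 0 ≤ 2 * Cχ ^ 2 * C := by positivity
          linarith

open Classical in
/-- The leading part of the mean of the coefficients of `S12` and `S22`. -/
def meanAdd (χ : EuclideanSpace ℝ (Fin 3) → ℝ) (s θ : ℝ) (N : ℕ) (j : Quad × Quad) : ℝ :=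
  ∑ n ∈ freqBox N, (if Admissible θ (shiftAdd j.1 - n) n j.1 j.2 then
    2 * cutoffAt χ N (shiftAdd j.1 - n) ^ 2 * addSymbol s (shiftAdd j.1 - n) n else 0) *
      (cutoffAt χ N n ^ 2 * coeffVar s n)

/-- Unlike the full weight, the leading part sees the quadruples only through `shiftAdd` and the
symmetric size constraint. -/
lemma meanAdd_swap (χ : EuclideanSpace ℝ (Fin 3) → ℝ) (s θ : ℝ) (N : ℕ) {a b : Quad}
    (h : shiftAdd a = shiftAdd b) : meanAdd χ s θ N (b, a) = meanAdd χ s θ N (a, b) := by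
  have e : ∀ x y, Admissible θ x y b a ↔ Admissible θ x y a b := fun x y => and_comm
  classical
  simp only [meanAdd]
  refine Finset.sum_congr rfl fun n _ => ?_
  rw [h]
  congr 1
  exact if_congr (e _ _) rfl rfl

lemma sum_lowAdd_mul_meanAdd (χ : EuclideanSpace ℝ (Fin 3) → ℝ) (s θ : ℝ) (N : ℕ)
    (box : Finset Freq) (w : Freq → ℂ) :
    ∑ j ∈ pairIndex box shiftAdd, (lowAdd j w).im * meanAdd χ s θ N j = 0 := by
  have hstar : ∀ a b : Quad, (lowAdd (b, a) w).im = -(lowAdd (a, b) w).im := by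
    intro a b
    have : lowAdd (b, a) w = star (lowAdd (a, b) w) := by
      simp only [lowAdd, star_mul', star_star]; ring
    rw [this]
    exact Complex.conj_im _
  have h1 : ∑ j ∈ pairIndex box shiftAdd, (lowAdd j w).im * meanAdd χ s θ N j =
      ∑ j ∈ pairIndex box shiftAdd, -((lowAdd j w).im * meanAdd χ s θ N j) := by
    refine Finset.sum_equiv (Equiv.prodComm _ _) ?_ ?_
    · rintro ⟨a, b⟩
      simp only [pairIndex, Finset.mem_filter, Finset.mem_product, Equiv.prodComm_apply,
        Prod.swap_prod_mk]
      tauto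
    · rintro ⟨a, b⟩ hj
      have hab : shiftAdd a = shiftAdd b := (Finset.mem_filter.mp hj).2
      rw [Equiv.prodComm_apply, Prod.swap_prod_mk, meanAdd_swap χ s θ N hab, hstar a b]
      ring
  rw [Finset.sum_neg_distrib] at h1
  linarith

/-- The two leading means add up instead of cancelling, hence the factor `2` in `meanAdd`; that part
is removed only after summation over `(a, b)`, by `sum_lowAdd_mul_meanAdd`. -/
lemma abs_add_coeff_le {χ : EuclideanSpace ℝ (Fin 3) → ℝ} {Cχ : ℝ}
    (hCχ : ∀ N k, |cutoffAt χ N k| ≤ Cχ) {η : ℝ → ℝ} (hη : IsBump η) {s θ δ₀ : ℝ} (hs : 1 ≤ s)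
    (hθ₀ : 0 < θ) (hθ : θ < 1 / 3) (hδ0 : 0 ≤ δ₀) (hδ : δ₀ ≤ 2 / 3) :
    ∃ C : ℝ, 0 < C ∧ ∀ (N : ℕ) (j : Quad × Quad),
      (∀ n, |coeff12 χ η s θ δ₀ N j n + coeff22 χ η s θ δ₀ N j n| ≤
        C * (1 + lowSum j.1) ^ 2 * jb n ^ (2 * s - 2)) ∧
      |∑ n ∈ freqBox N, (coeff12 χ η s θ δ₀ N j n + coeff22 χ η s θ δ₀ N j n) *
        (cutoffAt χ N n ^ 2 * coeffVar s n) - meanAdd χ s θ N j| ≤ C * (1 + lowSum j.1) ^ 2 := by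
  classical
  obtain ⟨C, hC, hest⟩ := weight_tupleAdd_estimates hη hs hθ₀ hθ hδ0 hδ
  set S : ℝ := ∑' n : Freq, jb n ^ (-(10 / 3) : ℝ) with hS
  have hS0 : 0 ≤ S := tsum_nonneg fun k => Real.rpow_nonneg (jb_pos k).le _
  refine ⟨2 * Cχ ^ 2 * C + 2 * Cχ ^ 4 * C * S + 1, by positivity, ?_⟩
  rintro N ⟨a, b⟩
  have hK : 0 ≤ (1 + lowSum a) ^ 2 := sq_nonneg _
  set h := shiftAdd a with hh
  constructor
  · intro n
    have hP := Real.rpow_nonneg (jb_pos n).le (2 * s - 2)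
    have hbase : 0 ≤ Cχ ^ 2 * (C * (1 + lowSum a) ^ 2 * jb n ^ (2 * s - 2)) := by positivity
    have h1 : |coeff12 χ η s θ δ₀ N (a, b) n| ≤
        Cχ ^ 2 * (C * (1 + lowSum a) ^ 2 * jb n ^ (2 * s - 2)) := by
      rw [coeff12]
      split_ifs with hadm
      · rw [abs_mul, abs_of_nonneg (sq_nonneg _)]
        exact mul_le_mul (sq_le_of_abs_le (hCχ _ _))
          (hest _ _ _ _ (Or.inl rfl) (abs_freqNorm_shiftAdd a n) hadm.1).1 (abs_nonneg _)
          (sq_nonneg _)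
      · rwa [abs_zero]
    have h2 : |coeff22 χ η s θ δ₀ N (a, b) n| ≤
        Cχ ^ 2 * (C * (1 + lowSum a) ^ 2 * jb n ^ (2 * s - 2)) := by
      rw [coeff22]
      split_ifs with hadm
      · rw [abs_mul, abs_of_nonneg (sq_nonneg _)]
        exact mul_le_mul (sq_le_of_abs_le (hCχ _ _))
          (hest _ _ _ _ (Or.inr rfl) (abs_freqNorm_shiftAdd a n) hadm.1).1 (abs_nonneg _)
          (sq_nonneg _)
      · rwa [abs_zero]
    calc _ ≤ _ := abs_add_le _ _
      _ ≤ _ := add_le_add h1 h2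
      _ = 2 * Cχ ^ 2 * C * ((1 + lowSum a) ^ 2 * jb n ^ (2 * s - 2)) := by ring
      _ ≤ (2 * Cχ ^ 2 * C + 2 * Cχ ^ 4 * C * S + 1) *
          ((1 + lowSum a) ^ 2 * jb n ^ (2 * s - 2)) := by
          gcongr
          have : 0 ≤ 2 * Cχ ^ 4 * C * S := by positivity
          linarith
      _ = _ := by ring
  · rw [meanAdd, ← Finset.sum_sub_distrib]
    calc _ ≤ _ := Finset.abs_sum_le_sum_abs _ _
      _ ≤ ∑ n ∈ freqBox N, 2 * Cχ ^ 4 * (C * (1 + lowSum a) ^ 2) * jb n ^ (-(10 / 3) : ℝ) := by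
          refine Finset.sum_le_sum fun n _ => ?_
          have hP := Real.rpow_nonneg (jb_pos n).le (-(10 / 3))
          have hcv := coeffVar_pos s n
          simp only [coeff12, coeff22, ← hh]
          split_ifs with hadm
          · have b1 := (hest _ _ _ _ (Or.inl rfl) (abs_freqNorm_shiftAdd a n) hadm.1).2
            have b2 := (hest _ _ _ _ (Or.inr rfl) (abs_freqNorm_shiftAdd a n) hadm.1).2
            rw [← hh] at b1 b2
            set m₁ := weight η s δ₀ (tupleOdd (h - n) n a) - addSymbol s (h - n) n with hm₁
            set m₂ := weight η s δ₀ (tupleEven (h - n) n a) - addSymbol s (h - n) n with hm₂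
            have e : (cutoffAt χ N (h - n) ^ 2 * weight η s δ₀ (tupleOdd (h - n) n a) +
                cutoffAt χ N (h - n) ^ 2 * weight η s δ₀ (tupleEven (h - n) n a)) *
                (cutoffAt χ N n ^ 2 * coeffVar s n) -
                2 * cutoffAt χ N (h - n) ^ 2 * addSymbol s (h - n) n *
                (cutoffAt χ N n ^ 2 * coeffVar s n) =
                cutoffAt χ N (h - n) ^ 2 * cutoffAt χ N n ^ 2 *
                  ((m₁ + m₂) * coeffVar s n) := by
              rw [hm₁, hm₂]; ring
            rw [e, abs_mul, abs_of_nonneg (by positivity)]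
            have b3 : |(m₁ + m₂) * coeffVar s n| ≤
                2 * (C * (1 + lowSum a) ^ 2 * jb n ^ (-(10 / 3) : ℝ)) := by
              rw [abs_mul, abs_of_pos hcv]
              calc _ ≤ (|m₁| + |m₂|) * coeffVar s n := by gcongr; exact abs_add_le _ _
                _ ≤ _ := by rw [add_mul]; linarith
            calc _ ≤ Cχ ^ 2 * Cχ ^ 2 * (2 * (C * (1 + lowSum a) ^ 2 * jb n ^ (-(10 / 3) : ℝ))) := by
                  refine mul_le_mul ?_ b3 (abs_nonneg _) (by positivity)
                  exact mul_le_mul (sq_le_of_abs_le (hCχ _ _)) (sq_le_of_abs_le (hCχ _ _))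
                    (sq_nonneg _) (sq_nonneg _)
              _ = _ := by ring
          · simp only [add_zero, zero_mul, sub_self, abs_zero]
            positivity
      _ ≤ 2 * Cχ ^ 4 * (C * (1 + lowSum a) ^ 2) * S := by
          rw [← Finset.mul_sum]
          gcongr
          exact sum_jb_le _
      _ = 2 * Cχ ^ 4 * C * S * (1 + lowSum a) ^ 2 := by ring
      _ ≤ _ := by
          gcongr
          have : 0 ≤ 2 * Cχ ^ 2 * C := by positivity
          linarith

/-! ### The two differences as localized quadratic forms -/

lemma imDiff1_eq {χ : EuclideanSpace ℝ (Fin 3) → ℝ} (hχ : IsRadialCutoff χ) (η : ℝ → ℝ)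
    (s θ δ₀ σ R : ℝ) {N : ℕ} (hN : 1 ≤ N) :
    imDiff1 χ η s θ δ₀ σ R N = fun v => localizedForm σ R (pairIndex (freqBox N) shiftDiff)
      (freqBox N) (fun j w => (lowDiff j w).im)
      (fun j n => coeff11 χ η s θ δ₀ N j n - coeff21 χ η s θ δ₀ N j n)
      (symbolMul (cutoffAt χ N) v) := by
  classical
  funext v
  have hw : ∀ n ∉ freqBox N, symbolMul (cutoffAt χ N) v n = 0 := fun n hn => by
    simp [symbolMul, cutoffAt_eq_zero hχ hN hn]
  change (sobolevBall σ R).indicator _ (symbolMul (cutoffAt χ N) v) = _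
  rw [localizedForm, Set.indicator_apply, Set.indicator_apply,
    S11_eq_sum χ η s θ δ₀ N hw, S21_eq_sum χ η s θ δ₀ N hw, ← Finset.sum_sub_distrib]
  simp only [← mul_sub, ← Complex.ofReal_sub, Complex.im_sum, Complex.im_mul_ofReal, sub_mul,
    Finset.sum_sub_distrib]

/-- Conjugation of the low factor in `S22` flips the sign of its imaginary part, so the coefficients
are added. -/
lemma imDiff2_eq {χ : EuclideanSpace ℝ (Fin 3) → ℝ} (hχ : IsRadialCutoff χ) (η : ℝ → ℝ)
    (s θ δ₀ σ R : ℝ) {N : ℕ} (hN : 1 ≤ N) :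
    imDiff2 χ η s θ δ₀ σ R N = fun v => localizedForm σ R (pairIndex (freqBox N) shiftAdd)
      (freqBox N) (fun j w => (lowAdd j w).im)
      (fun j n => coeff12 χ η s θ δ₀ N j n + coeff22 χ η s θ δ₀ N j n)
      (symbolMul (cutoffAt χ N) v) := by
  classical
  funext v
  have hw : ∀ n ∉ freqBox N, symbolMul (cutoffAt χ N) v n = 0 := fun n hn => by
    simp [symbolMul, cutoffAt_eq_zero hχ hN hn]
  change (sobolevBall σ R).indicator _ (symbolMul (cutoffAt χ N) v) = _
  rw [localizedForm, Set.indicator_apply, Set.indicator_apply,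
    S12_eq_sum χ η s θ δ₀ N hw, S22_eq_sum χ η s θ δ₀ N hw]
  have hstar : ∀ z : ℂ, (star z).im = -z.im := Complex.conj_im
  simp only [Complex.sub_im, Complex.im_sum, Complex.im_mul_ofReal, hstar, add_mul,
    Finset.sum_add_distrib, mul_add, neg_mul, Finset.sum_neg_distrib, sub_neg_eq_add]

end NLSPairing

end

/-! ### The moment estimate -/

open NLSPairing in
theorem proposition7p1 (s θ : ℝ) (hs : 10 ≤ s) (hθ₀ : 0 < θ) (hθ : θ < 1 / 3) :
    ∃ β : ℝ, 0 < β ∧ β < 1 ∧ ∃ σ₀ : ℝ, σ₀ < s - 3 / 2 ∧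
      ∀ σ : ℝ, σ₀ < σ → σ < s - 3 / 2 →
      ∀ δ₀ : ℝ, 2 * θ < δ₀ → δ₀ < 2 / 3 →
      ∀ (χ : EuclideanSpace ℝ (Fin 3) → ℝ) (η : ℝ → ℝ),
        NLSPairing.IsRadialCutoff χ → NLSPairing.IsBump η →
      ∃ C : ℝ, 0 < C ∧ ∀ N : ℕ, 1 ≤ N → ∀ R : ℝ, 1 ≤ R → ∀ p : ℝ, 2 ≤ p →
        (MemLp (NLSPairing.imDiff1 χ η s θ δ₀ σ R N) (ENNReal.ofReal p)
            (NLSPairing.gaussianMeasure s) ∧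
          eLpNorm (NLSPairing.imDiff1 χ η s θ δ₀ σ R N) (ENNReal.ofReal p)
            (NLSPairing.gaussianMeasure s) ≤ ENNReal.ofReal (C * p ^ β * R ^ 10)) ∧
        (MemLp (NLSPairing.imDiff2 χ η s θ δ₀ σ R N) (ENNReal.ofReal p)
            (NLSPairing.gaussianMeasure s) ∧
          eLpNorm (NLSPairing.imDiff2 χ η s θ δ₀ σ R N) (ENNReal.ofReal p)
            (NLSPairing.gaussianMeasure s) ≤ ENNReal.ofReal (C * p ^ β * R ^ 10)) := by
  -- The exponent is that of `√p`. The regularity `s - 2` is what `low_sum_le` needs, and with `10 ≤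
  -- s` it gives `8 ≤ σ` for `sum_lowSize_le`.
  refine ⟨1 / 2, by norm_num, by norm_num, s - 2, by linarith, ?_⟩
  intro σ hσ _ δ₀ hδ0 hδ χ η hχ hη
  obtain ⟨Cχ, -, hCχ⟩ := hχ.exists_bound
  obtain ⟨C₀, hC₀, hform⟩ := eLpNorm_localizedForm_le s Cχ (by linarith)
  obtain ⟨Q, hQ, hsum⟩ := sum_lowSize_le (σ := σ) (by linarith)
  obtain ⟨C₁, hC₁, hdiff⟩ := abs_diff_coeff_le hCχ hη (s := s) (θ := θ) (δ₀ := δ₀) (by linarith)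
    hθ₀ hθ (by linarith) hδ.le hχ
  obtain ⟨C₂, hC₂, hadd⟩ := abs_add_coeff_le hCχ hη (s := s) (θ := θ) (δ₀ := δ₀) (by linarith)
    hθ₀ hθ (by linarith) hδ.le
  refine ⟨C₀ * (C₁ * Q + C₂ * Q), by positivity, fun N hN R hR p hp => ?_⟩
  have hz : ∀ k ∉ freqBox N, cutoffAt χ N k = 0 := fun k hk => cutoffAt_eq_zero hχ hN hk
  have hsumC : ∀ (C : ℝ) (h : Quad → Freq), 0 < C → C * Q ≤ C₁ * Q + C₂ * Q →
      ∑ j ∈ pairIndex (freqBox N) h, lowSize σ j * (C * (1 + lowSum j.1) ^ 2) ≤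
        C₁ * Q + C₂ * Q := by
    intro C h hC hle
    calc _ = C * ∑ j ∈ pairIndex (freqBox N) h, lowSize σ j * (1 + lowSum j.1) ^ 2 := by
          rw [Finset.mul_sum]; exact Finset.sum_congr rfl fun j _ => by ring
      _ ≤ C * Q := by gcongr; exact hsum _ _
      _ ≤ _ := hle
  have hKpos : ∀ (C : ℝ) (j : Quad × Quad), 0 < C → 0 < C * (1 + lowSum j.1) ^ 2 := fun C j hC => by
    have := lowSum_nonneg j.1
    positivity
  have hmem : ∀ f : (Freq → ℂ) → ℝ, Measurable f →
      eLpNorm f (ENNReal.ofReal p) (gaussianMeasure s) ≤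
        ENNReal.ofReal (C₀ * (C₁ * Q + C₂ * Q) * √p * R ^ 10) →
      MemLp f (ENNReal.ofReal p) (gaussianMeasure s) ∧
        eLpNorm f (ENNReal.ofReal p) (gaussianMeasure s) ≤
          ENNReal.ofReal (C₀ * (C₁ * Q + C₂ * Q) * p ^ (1 / 2 : ℝ) * R ^ 10) := by
    intro f hf hle
    rw [← Real.sqrt_eq_rpow]
    exact ⟨⟨hf.aestronglyMeasurable, hle.trans_lt ENNReal.ofReal_lt_top⟩, hle⟩
  constructor
  · rw [imDiff1_eq hχ η s θ δ₀ σ R hN]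
    refine hmem _ (measurable_localizedForm σ R _ _ hz fun j _ => measurable_lowDiff j) ?_
    refine hform _ _ (freqBox N) (cutoffAt χ N) _ _ (lowSize σ)
      (fun j => C₁ * (1 + lowSum j.1) ^ 2) (fun _ => 0) σ R p _ hσ.le hR (by linarith) hz
      (hCχ N) (fun j _ => measurable_lowDiff j) (fun j _ => lowSize_nonneg σ j)
      (fun j _ => hKpos C₁ j hC₁) (fun j _ w hw => ?_) (fun j _ n _ => (hdiff N j hN).1 n)
      (fun j _ => ?_) (fun w => by simp) (hsumC C₁ _ hC₁ ?_)
    · refine (Complex.abs_im_le_norm _).trans ?_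
      rw [norm_lowDiff]
      exact prod_norm_le_lowSize (by linarith) (by linarith) hw j
    · rw [sub_zero]
      exact (hdiff N j hN).2
    · have : 0 < C₂ * Q := by positivity
      linarith
  · rw [imDiff2_eq hχ η s θ δ₀ σ R hN]
    refine hmem _ (measurable_localizedForm σ R _ _ hz fun j _ => measurable_lowAdd j) ?_
    refine hform _ _ (freqBox N) (cutoffAt χ N) _ _ (lowSize σ)
      (fun j => C₂ * (1 + lowSum j.1) ^ 2) (meanAdd χ s θ N) σ R p _ hσ.le hR (by linarith) hz
      (hCχ N) (fun j _ => measurable_lowAdd j) (fun j _ => lowSize_nonneg σ j)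
      (fun j _ => hKpos C₂ j hC₂) (fun j _ w hw => ?_) (fun j _ n _ => (hadd N j).1 n)
      (fun j _ => (hadd N j).2) (fun w => sum_lowAdd_mul_meanAdd χ s θ N _ w)
      (hsumC C₂ _ hC₂ ?_)
    · refine (Complex.abs_im_le_norm _).trans ?_
      rw [norm_lowAdd]
      exact prod_norm_le_lowSize (by linarith) (by linarith) hw j
    · have : 0 < C₁ * Q := by positivity
      linarith
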